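/- **Setting.** Let $n,d\ge 1$ and let $f_1,\dots,f_n:\mathbb R^d\to\mathbb R$ be differentiable with $L$-Lipschitz gradients, $\|\nabla f_i(z)-\nabla f_i(z')\|_2\le L\|z-z'\|_2$, and such that $f=\frac1n\sum_{i=1}^n f_i$ is $\mu$-strongly convex, $f(z')\ge f(z)+\langle\nabla f(z),z'-z\rangle+\frac\mu2\|z'-z\|_2^2$ for all $z,z'$, where $\mu,L>0$. Put $\kappa=L/\mu$ and let $x^*$ be the minimizer of $f$. Let $W_1,W_2,W_3,W_4\in\mathbb R^{n\times n}$ be communication matrices of a network on $n$ nodes: symmetric, doubly stochastic, with positive diagonal, and with $(i,j)$ entry $0$ whenever $i\ne j$ are not joined by an edge. Put $Z_i=W_i\otimes I_d$ and $\beta_i=\|W_i-\frac1n 1_n1_n^T\|_2$ (spectral norm). For integers $n_c\ge1$, $1\le n_g<\infty$ and a step size $\alpha>0$, the algorithm GTA starts from any $\mathbf x_{0,1}\in\mathbb R^{nd}$ with $\mathbf y_{0,1}=\nabla\mathbf f(\mathbf x_{0,1})$, where $\nabla\mathbf f(\mathbf x)$ stacks the vectors $\nabla f_i(x_i)$, and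 for $k=0,1,2,\dots$ performs $$\mathbf x_{k,j+1}=\mathbf x_{k,j}-\alpha\mathbf y_{k,j},\qquad \mathbf y_{k,j+1}=\mathbf y_{k,j}+\nabla\mathbf f(\mathbf x_{k,j+1})-\nabla\mathbf f(\mathbf x_{k,j})\qquad(1\le j\le n_g-1),$$ $$\mathbf x_{k+1,1}=Z_1^{n_c}\mathbf x_{k,n_g}-\alpha Z_2^{n_c}\mathbf y_{k,n_g},\qquad \mathbf y_{k+1,1}=Z_3^{n_c}\mathbf y_{k,n_g}+Z_4^{n_c}\big(\nabla\mathbf f(\mathbf x_{k+1,1})-\nabla\mathbf f(\mathbf x_{k,n_g})\big).$$ Let $\bar x$ denote the average of the $n$ blocks of $\mathbf x\in\mathbb R^{nd}$ and $\bar{\mathbf x}\in\mathbb R^{nd}$ that average repeated $n$ times (similarly for $\mathbf y$), and let $$r_k=\big(\|\bar x_{k,1}-x^*\|_2,\ \|\mathbf x_{k,1}-\bar{\mathbf x}_{k,1}\|_2,\ \|\mathbf y_{k,1}-\bar{\mathbf y}_{k,1}\|_2\big)^T\in\mathbb R^3 .$$ Define $$\delta_1=2\beta_2^{n_c}+\beta_1^{n_c}(n_g-2),\qquad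 \delta_2=2\Big(\beta_4^{n_c}\|Z_1^{n_c}-I_{nd}\|_2+\tfrac{\beta_4^{n_c}}{n_g}+\beta_3^{n_c}\Big),$$ and $B(n_c,n_g)=A+\alpha L(n_g-1)E$ with $$A=\begin{bmatrix}(1-\alpha\mu)^{n_g}&\frac{\kappa}{\sqrt n}\big(1-(1-\alpha\mu)^{n_g}\big)&0\\0&\beta_1^{n_c}&\alpha\big((n_g-1)\beta_1^{n_c}+\beta_2^{n_c}\big)\\\sqrt n\,\alpha\beta_4^{n_c}L^2&\beta_4^{n_c}L\big(\|Z_1^{n_c}-I_{nd}\|_2+\alpha L\big)&\beta_3^{n_c}+\alpha\beta_4^{n_c}L\end{bmatrix},$$ $$E=\begin{bmatrix}\alpha Ln_g&\frac{\alpha Ln_g}{\sqrt n}&\frac{\alpha n_g}{\sqrt n}\\\sqrt n\,\alpha L\delta_1&\alpha L\delta_1&\alpha\delta_1\\\sqrt n\,L\delta_2&L\delta_2&\delta_2\end{bmatrix}.$$ Further let $$\begin{aligned}b_1={}&\tfrac{\mu L^2n_g}{2}\big[(n_g-1)(\beta_1^{n_c}+\delta_1)+\beta_2^{n_c}\big]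\big[\beta_4^{n_c}+(n_g-1)\delta_2\big]\\&+L^3n_g(n_g-1)\Big[\delta_1\tfrac{1-\beta_3^{n_c}}4+\big(\beta_4^{n_c}+(n_g-1)\delta_2\big)\tfrac{1-\beta_1^{n_c}}4\Big]\\&+L^2(n_g-1)^2\Big[L\delta_1\big(3\beta_4^{n_c}+(n_g-1)\delta_2\big)+\delta_1\tfrac{1-\beta_3^{n_c}}4\Big]\\&+L^2\big[\beta_4^{n_c}+(n_g-1)\delta_2\big]\big[Ln_g+(n_g-1)\big]\big[(n_g-1)(\beta_1^{n_c}+\delta_1)+\beta_2^{n_c}\big],\\ b_2={}&\mu n_g\beta_4^{n_c}L\big((n_g-1)(\beta_1^{n_c}+\delta_1)+\beta_2^{n_c}\big),\qquad b_3=\tfrac{\mu n_g}2\cdot\tfrac{1-\beta_1^{n_c}}4\cdot\tfrac{1-\beta_3^{n_c}}4 .\end{aligned}$$ **Theorem.** Suppose that $B(n_c,n_g)$ is irreducible, that $\beta_1,\beta_3<1$, and that $$0<\alpha<\min\left\{\tfrac1{n_gL},\ \tfrac{\mu}{(2L^2+\mu^2)(n_g-1)},\ \tfrac1{2L}\sqrt{\tfrac{3(1-\beta_1^{n_c})}{\delta_1(n_g-1)}},\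 \tfrac{3(1-\beta_3^{n_c})}{4L(\beta_4^{n_c}+\delta_2(n_g-1))},\ \tfrac{-b_2+\sqrt{b_2^2+4b_1b_3}}{2b_1}\right\},$$ where the second and the third term are read as $+\infty$ when their denominators vanish (the denominators of the other terms are positive under these hypotheses). Then the spectral radius satisfies $\rho(B(n_c,n_g))<1$, and for every $\epsilon>0$ there is a constant $C_\epsilon>0$, independent of the functions $f_i$ and of the starting point $\mathbf x_{0,1}$, such that for all $k\ge0$ $$\|r_k\|_2\le C_\epsilon\big(\rho(B(n_c,n_g))+\epsilon\big)^k\|r_0\|_2 .$$ -/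

import Mathlib

open scoped Kronecker Gradient

noncomputable section

/-- The Euclidean space `ℝ^d`. -/
abbrev Vec (d : ℕ) := EuclideanSpace ℝ (Fin d)

/-- The space `ℝ^{nd}` of stacked vectors; the coordinate `(i, a)` is the `a`-th coordinate of the
local copy held by node `i`. -/
abbrev Stacked (n d : ℕ) := EuclideanSpace ℝ (Fin n × Fin d)

/-- The local copy (block) of node `i` in a stacked vector. -/
def localCopy {n d : ℕ} (x : Stacked n d) (i : Fin n) : Vec d :=
  WithLp.toLp 2 (fun a => x (i, a))

/-- Concatenation of `n` local vectors into a stacked vector. -/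
def stack {n d : ℕ} (v : Fin n → Vec d) : Stacked n d :=
  WithLp.toLp 2 (fun p => v p.1 p.2)

/-- The average `x̄ = (1/n) ∑ i, x_i` of the local copies. -/
def average {n d : ℕ} (x : Stacked n d) : Vec d :=
  (1 / (n : ℝ)) • ∑ i, localCopy x i

/-- The average of the local copies repeated `n` times. -/
def stackedAverage {n d : ℕ} (x : Stacked n d) : Stacked n d :=
  stack (fun _ => average x)

/-- The action of a square matrix on Euclidean space, as a bounded linear operator. -/
abbrev act {ι : Type*} [Fintype ι] [DecidableEq ι] (M : Matrix ι ι ℝ) :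
    EuclideanSpace ℝ ι →L[ℝ] EuclideanSpace ℝ ι :=
  Matrix.toEuclideanCLM (n := ι) (𝕜 := ℝ) M

/-- The spectral norm `‖M‖₂`: the operator norm for the Euclidean norm. -/
def specNorm {ι : Type*} [Fintype ι] [DecidableEq ι] (M : Matrix ι ι ℝ) : ℝ := ‖act M‖

/-- The spectral radius `ρ(M)` of a real square matrix: the largest modulus of its complex
eigenvalues. -/
def rho {ι : Type*} [Fintype ι] [DecidableEq ι] (M : Matrix ι ι ℝ) : ℝ :=
  (spectralRadius ℂ (M.map (algebraMap ℝ ℂ))).toReal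

/-- The matrix `1_n 1_nᵀ / n`. -/
def averagingMatrix (n : ℕ) : Matrix (Fin n) (Fin n) ℝ :=
  Matrix.of fun _ _ => 1 / (n : ℝ)

/-- A communication matrix for the network `G`: symmetric, doubly stochastic, with positive diagonal
and with zero entries between distinct nodes that are not joined by an edge (entries on edges are
only required to be nonnegative, which is part of being doubly stochastic). -/
structure IsCommunicationMatrix {n : ℕ} (G : SimpleGraph (Fin n))
    (U : Matrix (Fin n) (Fin n) ℝ) : Prop where
  symm : U.IsSymm
  doublyStochastic : U ∈ doublyStochastic ℝ (Fin n)
  diag_pos : ∀ i, 0 < U i i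
  eq_zero_of_not_adj : ∀ i j, i ≠ j → ¬ G.Adj i j → U i j = 0

/-- The global objective `f = (1/n) ∑ i, f_i`. -/
def globalObjective {n d : ℕ} (f : Fin n → Vec d → ℝ) (z : Vec d) : ℝ :=
  (1 / (n : ℝ)) * ∑ i, f i z

/-- The components `f_i` are differentiable with `L`-Lipschitz gradients, and the global objective is
`μ`-strongly convex. -/
structure StronglyConvexSmooth {n d : ℕ} (μ L : ℝ) (f : Fin n → Vec d → ℝ) : Prop where
  differentiable : ∀ i, Differentiable ℝ (f i)
  strongly_convex : ∀ z z' : Vec d,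
    globalObjective f z' ≥ globalObjective f z + inner ℝ (∇ (globalObjective f) z) (z' - z)
      + μ / 2 * ‖z' - z‖ ^ 2
  lipschitz_gradient : ∀ i, ∀ z z' : Vec d, ‖∇ (f i) z - ∇ (f i) z'‖ ≤ L * ‖z - z'‖

/-- The stacked gradient: node `i` evaluates `∇ f_i` at its own copy. -/
def stackedGradient {n d : ℕ} (f : Fin n → Vec d → ℝ) (x : Stacked n d) : Stacked n d :=
  stack (fun i => ∇ (f i) (localCopy x i))

/-- The data of the gradient tracking algorithm on `n` nodes, together with the problem constants:
the four communication matrices, the step size `α`, the strong convexity and Lipschitz constants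
`μ`, `L`, and the numbers `nc`, `ng` of communication and computation steps per outer iteration. -/
structure GTASetup (n : ℕ) where
  W₁ : Matrix (Fin n) (Fin n) ℝ
  W₂ : Matrix (Fin n) (Fin n) ℝ
  W₃ : Matrix (Fin n) (Fin n) ℝ
  W₄ : Matrix (Fin n) (Fin n) ℝ
  α : ℝ
  μ : ℝ
  L : ℝ
  nc : ℕ
  ng : ℕ

/-- `Z = W ⊗ I_d`. -/
def liftMatrix {n : ℕ} (d : ℕ) (W : Matrix (Fin n) (Fin n) ℝ) :
    Matrix (Fin n × Fin d) (Fin n × Fin d) ℝ :=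
  W ⊗ₖ (1 : Matrix (Fin d) (Fin d) ℝ)

namespace GTASetup

variable {n : ℕ} (S : GTASetup n)

/-! ### The algorithm -/

/-- One pass of the inner loop:
`x_{k,j+1} = x_{k,j} - α y_{k,j}`, `y_{k,j+1} = y_{k,j} + ∇f(x_{k,j+1}) - ∇f(x_{k,j})`. -/
def innerStep {d : ℕ} (f : Fin n → Vec d → ℝ) (s : Stacked n d × Stacked n d) :
    Stacked n d × Stacked n d :=
  let x' := s.1 - S.α • s.2
  (x', s.2 + stackedGradient f x' - stackedGradient f s.1)

/-- The communication step that ends an outer iteration: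
`x_{k+1,1} = Z₁^{nc} x_{k,ng} - α Z₂^{nc} y_{k,ng}`,
`y_{k+1,1} = Z₃^{nc} y_{k,ng} + Z₄^{nc} (∇f(x_{k+1,1}) - ∇f(x_{k,ng}))`. -/
def commStep {d : ℕ} (f : Fin n → Vec d → ℝ) (s : Stacked n d × Stacked n d) :
    Stacked n d × Stacked n d :=
  let x' := act (liftMatrix d S.W₁ ^ S.nc) s.1 - S.α • act (liftMatrix d S.W₂ ^ S.nc) s.2
  (x', act (liftMatrix d S.W₃ ^ S.nc) s.2
    + act (liftMatrix d S.W₄ ^ S.nc) (stackedGradient f x' - stackedGradient f s.1))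

/-- One outer iteration: `ng - 1` inner steps followed by the communication step. -/
def outerStep {d : ℕ} (f : Fin n → Vec d → ℝ) (s : Stacked n d × Stacked n d) :
    Stacked n d × Stacked n d :=
  S.commStep f ((S.innerStep f)^[S.ng - 1] s)

/-- The pair `(x_{k,1}, y_{k,1})` at the start of outer iteration `k`, where `x_{0,1} = x₀` and
`y_{0,1} = ∇f(x₀)`. -/
def iterate {d : ℕ} (f : Fin n → Vec d → ℝ) (x₀ : Stacked n d) (k : ℕ) :
    Stacked n d × Stacked n d :=
  (S.outerStep f)^[k] (x₀, stackedGradient f x₀)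

/-- The error vector
`r_k = (‖x̄_{k,1} - x*‖, ‖x_{k,1} - x̄_{k,1}‖, ‖y_{k,1} - ȳ_{k,1}‖)`. -/
def errorVec {d : ℕ} (f : Fin n → Vec d → ℝ) (xstar : Vec d) (x₀ : Stacked n d) (k : ℕ) :
    EuclideanSpace ℝ (Fin 3) :=
  let x := (S.iterate f x₀ k).1
  let y := (S.iterate f x₀ k).2
  !₂[‖average x - xstar‖, ‖x - stackedAverage x‖, ‖y - stackedAverage y‖]

/-! ### Network and problem constants -/

/-- `β₁ = ‖W₁ - 1 1ᵀ / n‖₂`. -/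
def β₁ : ℝ := specNorm (S.W₁ - averagingMatrix n)
/-- `β₂ = ‖W₂ - 1 1ᵀ / n‖₂`. -/
def β₂ : ℝ := specNorm (S.W₂ - averagingMatrix n)
/-- `β₃ = ‖W₃ - 1 1ᵀ / n‖₂`. -/
def β₃ : ℝ := specNorm (S.W₃ - averagingMatrix n)
/-- `β₄ = ‖W₄ - 1 1ᵀ / n‖₂`. -/
def β₄ : ℝ := specNorm (S.W₄ - averagingMatrix n)

/-- The condition number `κ = L / μ`. -/
def κ : ℝ := S.L / S.μ

/-- `‖Z₁^{nc} - I_{nd}‖₂`. -/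
def ζ (d : ℕ) : ℝ := specNorm (liftMatrix d S.W₁ ^ S.nc - 1)

def δ₁ : ℝ := 2 * S.β₂ ^ S.nc + S.β₁ ^ S.nc * ((S.ng : ℝ) - 2)

def δ₂ (d : ℕ) : ℝ := 2 * (S.β₄ ^ S.nc * S.ζ d + S.β₄ ^ S.nc / (S.ng : ℝ) + S.β₃ ^ S.nc)

/-! ### The matrix governing the error recursion -/

def matA (d : ℕ) : Matrix (Fin 3) (Fin 3) ℝ :=
  !![(1 - S.α * S.μ) ^ S.ng, S.κ / √(n : ℝ) * (1 - (1 - S.α * S.μ) ^ S.ng), 0;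
     0, S.β₁ ^ S.nc, S.α * (((S.ng : ℝ) - 1) * S.β₁ ^ S.nc + S.β₂ ^ S.nc);
     √(n : ℝ) * S.α * S.β₄ ^ S.nc * S.L ^ 2, S.β₄ ^ S.nc * S.L * (S.ζ d + S.α * S.L),
       S.β₃ ^ S.nc + S.α * S.β₄ ^ S.nc * S.L]

def matE (d : ℕ) : Matrix (Fin 3) (Fin 3) ℝ :=
  !![S.α * S.L * S.ng, S.α * S.L * S.ng / √(n : ℝ), S.α * S.ng / √(n : ℝ);
     √(n : ℝ) * S.α * S.L * S.δ₁, S.α * S.L * S.δ₁, S.α * S.δ₁;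
     √(n : ℝ) * S.L * S.δ₂ d, S.L * S.δ₂ d, S.δ₂ d]

/-- `B = A + α L (ng - 1) E`. -/
def matB (d : ℕ) : Matrix (Fin 3) (Fin 3) ℝ :=
  S.matA d + (S.α * S.L * ((S.ng : ℝ) - 1)) • S.matE d

/-! ### The step size bound -/

def b₁ (d : ℕ) : ℝ :=
  S.μ * S.L ^ 2 * S.ng / 2
      * (((S.ng : ℝ) - 1) * (S.β₁ ^ S.nc + S.δ₁) + S.β₂ ^ S.nc)
      * (S.β₄ ^ S.nc + ((S.ng : ℝ) - 1) * S.δ₂ d)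
  + S.L ^ 3 * S.ng * ((S.ng : ℝ) - 1)
      * (S.δ₁ * ((1 - S.β₃ ^ S.nc) / 4)
        + (S.β₄ ^ S.nc + ((S.ng : ℝ) - 1) * S.δ₂ d) * ((1 - S.β₁ ^ S.nc) / 4))
  + S.L ^ 2 * ((S.ng : ℝ) - 1) ^ 2
      * (S.L * S.δ₁ * (3 * S.β₄ ^ S.nc + ((S.ng : ℝ) - 1) * S.δ₂ d)
        + S.δ₁ * ((1 - S.β₃ ^ S.nc) / 4))
  + S.L ^ 2 * (S.β₄ ^ S.nc + ((S.ng : ℝ) - 1) * S.δ₂ d)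
      * (S.L * S.ng + ((S.ng : ℝ) - 1))
      * (((S.ng : ℝ) - 1) * (S.β₁ ^ S.nc + S.δ₁) + S.β₂ ^ S.nc)

def b₂ : ℝ :=
  S.μ * S.ng * S.β₄ ^ S.nc * S.L
    * (((S.ng : ℝ) - 1) * (S.β₁ ^ S.nc + S.δ₁) + S.β₂ ^ S.nc)

def b₃ : ℝ :=
  S.μ * S.ng / 2 * ((1 - S.β₁ ^ S.nc) / 4) * ((1 - S.β₃ ^ S.nc) / 4)

/-- The minimum of the five upper bounds on the step size, in the extended reals: a term whose
denominator vanishes is `+∞`, that is, imposes no restriction (the second and the third one when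
`ng = 1`, the third one also when `δ₁ = 0`). The denominators of the fourth and the fifth term are
positive whenever `B` is irreducible. -/
def stepBound (d : ℕ) : EReal :=
  ((1 / (S.ng * S.L) : ℝ) : EReal) ⊓
  (if S.ng = 1 then ⊤
    else ((S.μ / ((2 * S.L ^ 2 + S.μ ^ 2) * ((S.ng : ℝ) - 1)) : ℝ) : EReal)) ⊓
  (if S.δ₁ * ((S.ng : ℝ) - 1) = 0 then ⊤
    else ((1 / (2 * S.L)
      * √(3 * (1 - S.β₁ ^ S.nc) / (S.δ₁ * ((S.ng : ℝ) - 1))) : ℝ) : EReal)) ⊓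
  ((3 * (1 - S.β₃ ^ S.nc)
      / (4 * S.L * (S.β₄ ^ S.nc + S.δ₂ d * ((S.ng : ℝ) - 1))) : ℝ) : EReal) ⊓
  (((-S.b₂ + √(S.b₂ ^ 2 + 4 * S.b₁ d * S.b₃)) / (2 * S.b₁ d) : ℝ) : EReal)

end GTASetup

end

/-! ### Averages and lifted matrices -/

section Averages

variable {n d : ℕ}

/-! The average of `y` always equals the average of the local gradients at `x`. So the average
iterate performs `ng` gradient descent steps on the global objective per outer iteration, perturbed
only by the disagreement of the local copies. The exact step contracts by `1 - αμ`
(`norm_gradient_step_le`). Doubly stochastic communication fixes averages and shrinks deviations by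
`β ^ nc` (`norm_act_pow_sub_stackedAverage_le`).

The drift of the inner loop is governed by one scalar, `trackingBound`: T = ‖y - ȳ‖ + L‖x - x̄‖ + √n
L‖x̄ - x*‖. It dominates ‖y‖, and ‖x_j - x_0‖ ≤ 2αjT while jαL ≤ 1. This is why E has rank one: its
rows are multiples of (√n L, L, 1). Collecting terms gives r_{k+1} ≤ B r_k entrywise
(`errorVec_succ_le`). As B is nonnegative, r_k ≤ B^k r_0, and Gelfand's formula
(`exists_abs_pow_le`) bounds B^k with a constant depending only on B and ε.

For ρ(B) < 1 it suffices to find v > 0 with Bv < v. Lower the diagonal of I - B to simple constants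
and apply the adjugate of the result to the all-ones vector: this v works once the determinant is
positive (`rho_lt_one_of_det_pos`). Bounding the terms of the determinant and dividing by 2α leaves
the quadratic condition b₁α² + b₂α < b₃ (`det_pos_of_step_size`). -/

@[simp] lemma localCopy_apply (x : Stacked n d) (i : Fin n) (a : Fin d) :
    localCopy x i a = x (i, a) := rfl

@[simp] lemma stack_apply (v : Fin n → Vec d) (p : Fin n × Fin d) : stack v p = v p.1 p.2 := rfl

@[simp] lemma localCopy_stack (v : Fin n → Vec d) (i : Fin n) : localCopy (stack v) i = v i := rfl

@[simp] lemma localCopy_stackedAverage (x : Stacked n d) (i : Fin n) :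
    localCopy (stackedAverage x) i = average x := rfl

@[simp] lemma localCopy_sub (x y : Stacked n d) (i : Fin n) :
    localCopy (x - y) i = localCopy x i - localCopy y i := rfl

@[simp] lemma localCopy_add (x y : Stacked n d) (i : Fin n) :
    localCopy (x + y) i = localCopy x i + localCopy y i := rfl

@[simp] lemma localCopy_smul (c : ℝ) (x : Stacked n d) (i : Fin n) :
    localCopy (c • x) i = c • localCopy x i := rfl

lemma average_add (x y : Stacked n d) : average (x + y) = average x + average y := by
  simp [average, Finset.sum_add_distrib]

lemma average_sub (x y : Stacked n d) : average (x - y) = average x - average y := by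
  simp [average, Finset.sum_sub_distrib, smul_sub]

lemma average_smul (c : ℝ) (x : Stacked n d) : average (c • x) = c • average x := by
  simp only [average, localCopy_smul, ← Finset.smul_sum]
  rw [smul_comm]

lemma norm_sq_eq_sum_localCopy (x : Stacked n d) : ‖x‖ ^ 2 = ∑ i, ‖localCopy x i‖ ^ 2 := by
  simp [EuclideanSpace.norm_sq_eq, Fintype.sum_prod_type]

lemma inner_eq_sum_localCopy (x y : Stacked n d) :
    inner ℝ x y = ∑ i, inner ℝ (localCopy x i) (localCopy y i) := by
  simp [PiLp.inner_apply, Fintype.sum_prod_type]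

lemma average_apply (x : Stacked n d) (a : Fin d) :
    average x a = (1 / (n : ℝ)) * ∑ i, x (i, a) := by
  simp [average]

lemma average_stackedAverage (hn : 0 < n) (x : Stacked n d) :
    average (stackedAverage x) = average x := by
  have hn' : (n : ℝ) ≠ 0 := by positivity
  ext a
  rw [average_apply]
  simp only [stackedAverage, stack_apply, Finset.sum_const, Finset.card_univ, Fintype.card_fin,
    nsmul_eq_mul]
  field_simp

lemma norm_stackedAverage (x : Stacked n d) : ‖stackedAverage x‖ = √(n : ℝ) * ‖average x‖ := by
  have h : ‖stackedAverage x‖ ^ 2 = (√(n : ℝ) * ‖average x‖) ^ 2 := by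
    rw [norm_sq_eq_sum_localCopy, mul_pow, Real.sq_sqrt (by positivity)]
    simp [stackedAverage]
  exact (sq_eq_sq₀ (norm_nonneg _) (by positivity)).1 h

lemma stackedAverage_sub (x y : Stacked n d) :
    stackedAverage (x - y) = stackedAverage x - stackedAverage y := by
  ext p
  simp [stackedAverage, average_sub]

lemma stackedAverage_add (x y : Stacked n d) :
    stackedAverage (x + y) = stackedAverage x + stackedAverage y := by
  ext p
  simp [stackedAverage, average_add]

lemma stackedAverage_smul (c : ℝ) (x : Stacked n d) :
    stackedAverage (c • x) = c • stackedAverage x := by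
  ext p
  simp [stackedAverage, average_smul]

/-- The blocks of the deviation sum to zero, while the other factor has equal blocks. -/
lemma inner_sub_stackedAverage (hn : 0 < n) (x : Stacked n d) :
    inner ℝ (x - stackedAverage x) (stackedAverage x) = 0 := by
  have hn' : (n : ℝ) ≠ 0 := by positivity
  have h : ∑ i, localCopy (x - stackedAverage x) i = 0 := by
    ext a
    simp [stackedAverage, average_apply]
    field_simp
    simp
  rw [inner_eq_sum_localCopy]
  simp only [localCopy_stackedAverage]
  rw [← sum_inner, h, inner_zero_left]

lemma norm_sq_decomposition (hn : 0 < n) (x : Stacked n d) :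
    ‖x‖ ^ 2 = ‖x - stackedAverage x‖ ^ 2 + ‖stackedAverage x‖ ^ 2 := by
  have h := norm_add_sq_real (x - stackedAverage x) (stackedAverage x)
  rw [inner_sub_stackedAverage hn, sub_add_cancel] at h
  linarith

lemma norm_sub_stackedAverage_le (hn : 0 < n) (x : Stacked n d) :
    ‖x - stackedAverage x‖ ≤ ‖x‖ := by
  have h := norm_sq_decomposition hn x
  exact le_of_sq_le_sq (by nlinarith [sq_nonneg ‖stackedAverage x‖]) (norm_nonneg _)

lemma norm_stackedAverage_le (hn : 0 < n) (x : Stacked n d) : ‖stackedAverage x‖ ≤ ‖x‖ := by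
  have h := norm_sq_decomposition hn x
  exact le_of_sq_le_sq (by nlinarith [sq_nonneg ‖x - stackedAverage x‖]) (norm_nonneg _)

lemma sqrt_mul_norm_average_le (hn : 0 < n) (x : Stacked n d) : √(n : ℝ) * ‖average x‖ ≤ ‖x‖ := by
  rw [← norm_stackedAverage]; exact norm_stackedAverage_le hn x

/-! ### Communication operators W ⊗ I -/

lemma liftMatrix_pow (W : Matrix (Fin n) (Fin n) ℝ) (k : ℕ) :
    liftMatrix d W ^ k = liftMatrix d (W ^ k) := by
  induction k with
  | zero => simp [liftMatrix]
  | succ k ih =>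
    rw [pow_succ, ih, pow_succ, liftMatrix, liftMatrix, ← Matrix.mul_kronecker_mul, mul_one]
    rfl

lemma act_liftMatrix_apply (M : Matrix (Fin n) (Fin n) ℝ) (x : Stacked n d) (i : Fin n)
    (a : Fin d) : act (liftMatrix d M) x (i, a) = ∑ j, M i j * x (j, a) := by
  rw [Matrix.ofLp_toEuclideanCLM]
  simp [Matrix.mulVec, dotProduct, liftMatrix, Fintype.sum_prod_type, Matrix.one_apply]

lemma act_sub (M N : Matrix (Fin n) (Fin n) ℝ) (x : Stacked n d) :
    act (liftMatrix d (M - N)) x = act (liftMatrix d M) x - act (liftMatrix d N) x := by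
  ext ⟨i, a⟩
  simp [act_liftMatrix_apply, sub_mul, Finset.sum_sub_distrib]

/-- W ⊗ I acts separately on each of the `d` coordinates, so the squared norms add up over
coordinates. -/
lemma norm_act_liftMatrix_le (M : Matrix (Fin n) (Fin n) ℝ) (x : Stacked n d) :
    ‖act (liftMatrix d M) x‖ ≤ specNorm M * ‖x‖ := by
  have h0 : 0 ≤ specNorm M := norm_nonneg _
  refine le_of_sq_le_sq ?_ (by positivity)
  have hcol : ∀ (z : Stacked n d), ‖z‖ ^ 2
      = ∑ a, ‖(WithLp.toLp 2 (fun i => z (i, a)) : EuclideanSpace ℝ (Fin n))‖ ^ 2 := by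
    intro z
    simp [EuclideanSpace.norm_sq_eq, Fintype.sum_prod_type_right]
  rw [mul_pow, hcol, hcol x, Finset.mul_sum]
  refine Finset.sum_le_sum fun a _ => ?_
  have h1 : (WithLp.toLp 2 (fun i => act (liftMatrix d M) x (i, a)) : EuclideanSpace ℝ (Fin n))
      = act M (WithLp.toLp 2 (fun i => x (i, a))) := by
    ext i
    refine (act_liftMatrix_apply M x i a).trans ?_
    rw [Matrix.ofLp_toEuclideanCLM]
    rfl
  rw [h1, ← mul_pow]
  gcongr
  exact (act M).le_opNorm _

lemma act_averagingMatrix (x : Stacked n d) :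
    act (liftMatrix d (averagingMatrix n)) x = stackedAverage x := by
  ext ⟨i, a⟩
  rw [act_liftMatrix_apply]
  simp [stackedAverage, average_apply, averagingMatrix, Finset.mul_sum]

lemma averagingMatrix_mem (hn : 0 < n) : averagingMatrix n ∈ doublyStochastic ℝ (Fin n) := by
  have hn' : (n : ℝ) ≠ 0 := by positivity
  rw [mem_doublyStochastic_iff_sum]
  refine ⟨fun i j => ?_, fun i => ?_, fun i => ?_⟩ <;> simp [averagingMatrix, hn']

lemma mul_averagingMatrix {W : Matrix (Fin n) (Fin n) ℝ} (hW : W ∈ doublyStochastic ℝ (Fin n)) :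
    W * averagingMatrix n = averagingMatrix n := by
  rw [mem_doublyStochastic_iff_sum] at hW
  ext i j
  simp [Matrix.mul_apply, averagingMatrix, ← Finset.sum_mul, hW.2.1]

lemma averagingMatrix_mul {W : Matrix (Fin n) (Fin n) ℝ} (hW : W ∈ doublyStochastic ℝ (Fin n)) :
    averagingMatrix n * W = averagingMatrix n := by
  rw [mem_doublyStochastic_iff_sum] at hW
  ext i j
  simp [Matrix.mul_apply, averagingMatrix, ← Finset.mul_sum, hW.2.2]

/-- The averaging matrix J is idempotent and absorbs W from either side, so the cross terms
collapse. The exponent 0 must be excluded, since I - J differs from I. -/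
lemma pow_sub_averagingMatrix (hn : 0 < n) {W : Matrix (Fin n) (Fin n) ℝ}
    (hW : W ∈ doublyStochastic ℝ (Fin n)) {k : ℕ} (hk : 1 ≤ k) :
    W ^ k - averagingMatrix n = (W - averagingMatrix n) ^ k := by
  induction k, hk using Nat.le_induction with
  | base => simp
  | succ k hk ih =>
    rw [pow_succ (W - _), ← ih, sub_mul, mul_sub, mul_sub, mul_averagingMatrix (pow_mem hW k),
      averagingMatrix_mul hW, mul_averagingMatrix (averagingMatrix_mem hn), pow_succ]
    abel

lemma specNorm_pow_le (M : Matrix (Fin n) (Fin n) ℝ) {k : ℕ} (hk : 1 ≤ k) :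
    specNorm (M ^ k) ≤ specNorm M ^ k := by
  unfold specNorm
  rw [act, map_pow]
  exact norm_pow_le' _ hk

/-- Cauchy–Schwarz in each row, weighted by the row's entries, uses the row sums; exchanging the
order of summation then uses the column sums. -/
lemma specNorm_le_one {W : Matrix (Fin n) (Fin n) ℝ} (hW : W ∈ doublyStochastic ℝ (Fin n)) :
    specNorm W ≤ 1 := by
  rw [mem_doublyStochastic_iff_sum] at hW
  refine ContinuousLinearMap.opNorm_le_bound _ zero_le_one fun x => ?_
  rw [one_mul]
  refine le_of_sq_le_sq ?_ (norm_nonneg _)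
  rw [EuclideanSpace.norm_sq_eq, EuclideanSpace.norm_sq_eq, Matrix.ofLp_toEuclideanCLM]
  simp only [Real.norm_eq_abs, sq_abs, Matrix.mulVec, dotProduct]
  calc ∑ i, (∑ j, W i j * x j) ^ 2
      ≤ ∑ i, ∑ j, W i j * x j ^ 2 := by
        refine Finset.sum_le_sum fun i _ => ?_
        have := Finset.sum_sq_le_sum_mul_sum_of_sq_le_mul Finset.univ
          (r := fun j => W i j * x j) (f := fun j => W i j) (g := fun j => W i j * x j ^ 2)
          (fun j _ => hW.1 i j) (fun j _ => mul_nonneg (hW.1 i j) (sq_nonneg _))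
          (fun j _ => le_of_eq (by ring))
        rwa [hW.2.1, one_mul] at this
    _ = ∑ j, x j ^ 2 := by
        rw [Finset.sum_comm]
        refine Finset.sum_congr rfl fun j _ => ?_
        rw [← Finset.sum_mul, hW.2.2, one_mul]

lemma norm_act_pow_le {W : Matrix (Fin n) (Fin n) ℝ} (hW : W ∈ doublyStochastic ℝ (Fin n)) (k : ℕ)
    (x : Stacked n d) : ‖act (liftMatrix d W ^ k) x‖ ≤ ‖x‖ := by
  rw [liftMatrix_pow]
  refine (norm_act_liftMatrix_le _ _).trans ?_
  exact mul_le_of_le_one_left (norm_nonneg _) (specNorm_le_one (pow_mem hW k))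

lemma act_mul {ι : Type*} [Fintype ι] [DecidableEq ι] (M N : Matrix ι ι ℝ)
    (x : EuclideanSpace ℝ ι) : act (M * N) x = act M (act N x) := by
  rw [act, map_mul]; rfl

lemma liftMatrix_mul (M N : Matrix (Fin n) (Fin n) ℝ) :
    liftMatrix d (M * N) = liftMatrix d M * liftMatrix d N := by
  simp [liftMatrix, ← Matrix.mul_kronecker_mul]

lemma act_pow_stackedAverage {W : Matrix (Fin n) (Fin n) ℝ}
    (hW : W ∈ doublyStochastic ℝ (Fin n)) (k : ℕ) (x : Stacked n d) :
    act (liftMatrix d W ^ k) (stackedAverage x) = stackedAverage x := by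
  rw [← act_averagingMatrix, liftMatrix_pow, ← act_mul, ← liftMatrix_mul,
    mul_averagingMatrix (pow_mem hW k)]

lemma average_act_pow {W : Matrix (Fin n) (Fin n) ℝ}
    (hW : W ∈ doublyStochastic ℝ (Fin n)) (k : ℕ) (x : Stacked n d) :
    average (act (liftMatrix d W ^ k) x) = average x := by
  ext a
  rw [average_apply, average_apply, liftMatrix_pow]
  have h := pow_mem hW k
  rw [mem_doublyStochastic_iff_sum] at h
  simp only [act_liftMatrix_apply]
  rw [Finset.sum_comm]
  simp only [← Finset.sum_mul, h.2.2, one_mul]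

lemma stackedAverage_act_pow {W : Matrix (Fin n) (Fin n) ℝ}
    (hW : W ∈ doublyStochastic ℝ (Fin n)) (k : ℕ) (x : Stacked n d) :
    stackedAverage (act (liftMatrix d W ^ k) x) = stackedAverage x := by
  simp only [stackedAverage, average_act_pow hW]

/-- Communication contracts the consensus error. -/
lemma norm_act_pow_sub_stackedAverage_le (hn : 0 < n) {W : Matrix (Fin n) (Fin n) ℝ}
    (hW : W ∈ doublyStochastic ℝ (Fin n)) {k : ℕ} (hk : 1 ≤ k) (x : Stacked n d) :
    ‖act (liftMatrix d W ^ k) x - stackedAverage (act (liftMatrix d W ^ k) x)‖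
      ≤ specNorm (W - averagingMatrix n) ^ k * ‖x - stackedAverage x‖ := by
  have h : act (liftMatrix d W ^ k) x - stackedAverage (act (liftMatrix d W ^ k) x)
      = act (liftMatrix d ((W - averagingMatrix n) ^ k)) (x - stackedAverage x) := by
    rw [← pow_sub_averagingMatrix hn hW hk, act_sub, map_sub, map_sub, ← liftMatrix_pow,
      act_pow_stackedAverage hW, act_averagingMatrix, act_averagingMatrix,
      stackedAverage_act_pow hW]
    have : stackedAverage (stackedAverage x) = stackedAverage x := by
      simp only [stackedAverage]
      congr 1
      funext _
      exact average_stackedAverage hn x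
    rw [this]
    abel
  rw [h]
  refine (norm_act_liftMatrix_le _ _).trans ?_
  gcongr
  exact specNorm_pow_le _ hk

lemma specNorm_lift_pow_sub_one_le {W : Matrix (Fin n) (Fin n) ℝ}
    (hW : W ∈ doublyStochastic ℝ (Fin n)) (k : ℕ) :
    specNorm (liftMatrix d W ^ k - 1) ≤ 2 := by
  refine ContinuousLinearMap.opNorm_le_bound _ zero_le_two fun x => ?_
  rw [act, map_sub, map_one]
  calc ‖act (liftMatrix d W ^ k) x - x‖ ≤ ‖act (liftMatrix d W ^ k) x‖ + ‖x‖ := norm_sub_le _ _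
    _ ≤ 2 * ‖x‖ := by linarith [norm_act_pow_le hW k x]

/-- Communication moves a stacked vector by at most its consensus error times `‖Zᵏ - I‖₂`. -/
lemma norm_act_pow_sub_self_le {W : Matrix (Fin n) (Fin n) ℝ}
    (hW : W ∈ doublyStochastic ℝ (Fin n)) (k : ℕ) (x : Stacked n d) :
    ‖act (liftMatrix d W ^ k) x - x‖
      ≤ specNorm (liftMatrix d W ^ k - 1) * ‖x - stackedAverage x‖ := by
  have h : act (liftMatrix d W ^ k) x - x
      = act (liftMatrix d W ^ k - 1) (x - stackedAverage x) := by
    have h1 : ∀ y : Stacked n d, act (liftMatrix d W ^ k - 1) y = act (liftMatrix d W ^ k) y - y := by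
      intro y
      rw [act, act, map_sub, map_one]
      rfl
    rw [h1, map_sub, act_pow_stackedAverage hW]
    abel
  rw [h]
  exact (act (liftMatrix d W ^ k - 1)).le_opNorm _

end Averages

/-! ### Smooth and strongly convex functions -/

section SmoothConvex

variable {F : Type*} [NormedAddCommGroup F] [InnerProductSpace ℝ F]

/-- Cocoercivity of the gradient field `g` of a convex function `h` with quadratic upper bound. -/
lemma cocoercive_of_convex_smooth {h : F → ℝ} {g : F → F} {M : ℝ}
    (hconv : ∀ x y, h x + inner ℝ (g x) (y - x) ≤ h y)
    (hsm : ∀ x y, h y ≤ h x + inner ℝ (g x) (y - x) + M / 2 * ‖y - x‖ ^ 2) (t : ℝ) (x y : F) :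
    (2 * t - M * t ^ 2) * ‖g x - g y‖ ^ 2 ≤ inner ℝ (g x - g y) (x - y) := by
  -- Evaluate `h` at the trial point x - t(g x - g y), below by convexity from `y` and above by
  -- smoothness from `x`. Leaving `t` free avoids dividing by `M`, which may vanish.
  have key : ∀ x y : F, (t - M * t ^ 2 / 2) * ‖g x - g y‖ ^ 2
      ≤ h x - h y - inner ℝ (g y) (x - y) := by
    intro x y
    have h1 := hconv y (x - t • (g x - g y))
    have h2 := hsm x (x - t • (g x - g y))
    have e1 : x - t • (g x - g y) - x = -(t • (g x - g y)) := by abel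
    have e2 : x - t • (g x - g y) - y = (x - y) - t • (g x - g y) := by abel
    rw [e1, norm_neg, norm_smul, inner_neg_right, inner_smul_right, mul_pow, Real.norm_eq_abs,
      sq_abs] at h2
    rw [e2, inner_sub_right, inner_smul_right] at h1
    have e3 : inner ℝ (g x) (g x - g y) - inner ℝ (g y) (g x - g y) = ‖g x - g y‖ ^ 2 := by
      rw [← inner_sub_left, real_inner_self_eq_norm_sq]
    have e4 := congrArg (fun r => t * r) e3
    simp only [mul_sub] at e4
    linarith
  have h1 := key x y
  have h2 := key y x
  rw [norm_sub_rev (g y) (g x), ← neg_sub x y, inner_neg_right] at h2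
  rw [inner_sub_left]
  linarith

variable [CompleteSpace F]

/-- The descent lemma for functions with Lipschitz gradient. -/
lemma le_quadratic_of_lipschitz_gradient {f : F → ℝ} (hf : Differentiable ℝ f) {L : ℝ}
    (hL : ∀ x y, ‖∇ f x - ∇ f y‖ ≤ L * ‖x - y‖) (x y : F) :
    f y ≤ f x + inner ℝ (∇ f x) (y - x) + L / 2 * ‖y - x‖ ^ 2 := by
  have hd : ∀ t : ℝ, HasDerivAt (fun t : ℝ => f (x + t • (y - x)))
      (inner ℝ (∇ f (x + t • (y - x))) (y - x)) t := by
    intro t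
    have h1 : HasDerivAt (fun t : ℝ => x + t • (y - x)) (y - x) t := by
      simpa using ((hasDerivAt_id t).smul_const (y - x)).const_add x
    have h2 := (hf (x + t • (y - x))).hasFDerivAt.comp_hasDerivAt t h1
    rw [inner_gradient_left]
    exact h2
  have hB : ∀ t : ℝ, HasDerivAt
      (fun t : ℝ => f x + t * inner ℝ (∇ f x) (y - x) + L / 2 * t ^ 2 * ‖y - x‖ ^ 2)
      (inner ℝ (∇ f x) (y - x) + L * t * ‖y - x‖ ^ 2) t := by
    intro t
    have h1 := ((hasDerivAt_id t).mul_const (inner ℝ (∇ f x) (y - x))).const_add (f x)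
    have h2 := (((hasDerivAt_id t).pow 2).const_mul (L / 2)).mul_const (‖y - x‖ ^ 2)
    refine (h1.add h2).congr_deriv ?_
    simp only [id, Nat.cast_ofNat, Nat.add_one_sub_one, pow_one]
    ring
  have key := image_le_of_deriv_right_le_deriv_boundary (a := 0) (b := 1)
    (fun t _ => (hd t).continuousAt.continuousWithinAt)
    (fun t _ => (hd t).hasDerivWithinAt) (by simp)
    (fun t _ => (hB t).continuousAt.continuousWithinAt)
    (fun t _ => (hB t).hasDerivWithinAt) (fun t ht => ?_)
    (Set.right_mem_Icc.2 zero_le_one)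
  · simpa using key
  · have h1 : inner ℝ (∇ f (x + t • (y - x)) - ∇ f x) (y - x) ≤ L * t * ‖y - x‖ ^ 2 := by
      refine (real_inner_le_norm _ _).trans ?_
      have h2 := hL (x + t • (y - x)) x
      rw [add_sub_cancel_left, norm_smul, Real.norm_of_nonneg ht.1] at h2
      nlinarith [norm_nonneg (y - x)]
    rw [inner_sub_left] at h1
    linarith

/-- A gradient step on a strongly convex smooth function is a contraction. -/
lemma norm_gradient_step_le {f : F → ℝ} (hf : Differentiable ℝ f) {L μ α : ℝ}
    (hL : ∀ x y, ‖∇ f x - ∇ f y‖ ≤ L * ‖x - y‖)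
    (hμ : ∀ x y, f y ≥ f x + inner ℝ (∇ f x) (y - x) + μ / 2 * ‖y - x‖ ^ 2)
    (hα : 0 ≤ α) (hαL : α * L ≤ 1) (hαμ : α * μ < 1) (x y : F) :
    ‖(x - α • ∇ f x) - (y - α • ∇ f y)‖ ≤ (1 - α * μ) * ‖x - y‖ := by
  have hq : ∀ x y : F, ‖y‖ ^ 2 = ‖x‖ ^ 2 + 2 * inner ℝ x (y - x) + ‖y - x‖ ^ 2 := by
    intro x y
    have := norm_add_sq_real x (y - x)
    rwa [add_sub_cancel] at this
  -- Removing μ/2‖·‖² leaves a convex function with smoothness constant L - μ, and the step becomes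
  -- (1 - αμ)x - αg(x). With t = α/(1 - αμ), the condition αL ≤ 1 says exactly (L - μ)t ≤ 1.
  have hc := cocoercive_of_convex_smooth (h := fun z => f z - μ / 2 * ‖z‖ ^ 2)
    (g := fun z => ∇ f z - μ • z) (M := L - μ)
    (fun x y => by
      have h1 := hμ x y
      have h2 := congrArg (fun r => μ / 2 * r) (hq x y)
      simp only [inner_sub_left, inner_smul_left, RCLike.conj_to_real] at h2 ⊢
      linarith)
    (fun x y => by
      have h1 := le_quadratic_of_lipschitz_gradient hf hL x y
      have h2 := congrArg (fun r => μ / 2 * r) (hq x y)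
      simp only [inner_sub_left, inner_smul_left, RCLike.conj_to_real] at h2 ⊢
      linarith) (α / (1 - α * μ)) x y
  set D := (∇ f x - μ • x) - (∇ f y - μ • y) with hD
  have hpos : 0 < 1 - α * μ := by linarith
  have e : (x - α • ∇ f x) - (y - α • ∇ f y) = (1 - α * μ) • (x - y) - α • D := by
    rw [hD]; module
  refine le_of_sq_le_sq ?_ (by positivity)
  rw [e, norm_sub_sq_real, norm_smul, norm_smul, inner_smul_left, inner_smul_right,
    Real.norm_of_nonneg hpos.le, Real.norm_of_nonneg hα, RCLike.conj_to_real,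
    real_inner_comm]
  have h1 : α / (1 - α * μ) ≤ 2 * (α / (1 - α * μ)) - (L - μ) * (α / (1 - α * μ)) ^ 2 := by
    have : (L - μ) * (α / (1 - α * μ)) ≤ 1 := by
      rw [mul_div_assoc', div_le_one hpos]
      nlinarith
    have h0 : 0 ≤ α / (1 - α * μ) := by positivity
    nlinarith
  have h2 : α / (1 - α * μ) * ‖D‖ ^ 2 ≤ inner ℝ D (x - y) :=
    (mul_le_mul_of_nonneg_right h1 (by positivity)).trans hc
  have h3 : α * ‖D‖ ^ 2 ≤ (1 - α * μ) * inner ℝ D (x - y) := by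
    rw [div_mul_eq_mul_div, div_le_iff₀ hpos] at h2
    linarith
  have h4 : 0 ≤ α * ‖D‖ ^ 2 := by positivity
  nlinarith

end SmoothConvex

/-! ### The global objective and its averaged gradients -/

section Objective

variable {n d : ℕ} {μ L : ℝ} {f : Fin n → Vec d → ℝ}

lemma StronglyConvexSmooth.hasGradientAt (hf : StronglyConvexSmooth μ L f) (z : Vec d) :
    HasGradientAt (globalObjective f) ((1 / (n : ℝ)) • ∑ i, ∇ (f i) z) z := by
  have h : HasFDerivAt (fun z => ∑ i, f i z) (∑ i, fderiv ℝ (f i) z) z :=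
    HasFDerivAt.fun_sum fun i _ => (hf.differentiable i z).hasFDerivAt
  have h2 : HasFDerivAt (globalObjective f) _ z := h.const_mul (1 / (n : ℝ))
  rw [hasGradientAt_iff_hasFDerivAt]
  refine h2.congr_fderiv ?_
  simp only [gradient, map_smul, map_sum, LinearIsometryEquiv.apply_symm_apply]

lemma StronglyConvexSmooth.differentiable_globalObjective (hf : StronglyConvexSmooth μ L f) :
    Differentiable ℝ (globalObjective f) := fun z =>
  (hf.hasGradientAt z).differentiableAt

lemma average_stackedGradient_stackedAverage (hf : StronglyConvexSmooth μ L f) (x : Stacked n d) :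
    average (stackedGradient f (stackedAverage x)) = ∇ (globalObjective f) (average x) := by
  rw [(hf.hasGradientAt _).gradient]
  simp only [average, stackedGradient, localCopy_stack, localCopy_stackedAverage]

lemma norm_stackedGradient_sub_le (hL : 0 ≤ L) (hf : StronglyConvexSmooth μ L f)
    (x y : Stacked n d) : ‖stackedGradient f x - stackedGradient f y‖ ≤ L * ‖x - y‖ := by
  refine le_of_sq_le_sq ?_ (by positivity)
  rw [mul_pow, norm_sq_eq_sum_localCopy, norm_sq_eq_sum_localCopy, Finset.mul_sum]
  refine Finset.sum_le_sum fun i _ => ?_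
  rw [← mul_pow]
  gcongr
  rw [localCopy_sub, localCopy_sub]
  simp only [stackedGradient, localCopy_stack]
  exact hf.lipschitz_gradient i _ _

lemma norm_gradient_globalObjective_sub_le (hn : 0 < n) (hf : StronglyConvexSmooth μ L f)
    (x y : Vec d) :
    ‖∇ (globalObjective f) x - ∇ (globalObjective f) y‖ ≤ L * ‖x - y‖ := by
  have hn' : (0 : ℝ) < n := by positivity
  rw [(hf.hasGradientAt _).gradient, (hf.hasGradientAt _).gradient, ← smul_sub,
    ← Finset.sum_sub_distrib, norm_smul, Real.norm_of_nonneg (by positivity)]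
  have h : ‖∑ i, (∇ (f i) x - ∇ (f i) y)‖ ≤ n * (L * ‖x - y‖) := by
    refine (norm_sum_le _ _).trans ?_
    refine (Finset.sum_le_sum fun i _ => hf.lipschitz_gradient i x y).trans ?_
    simp
  calc 1 / (n : ℝ) * ‖∑ i, (∇ (f i) x - ∇ (f i) y)‖ ≤ 1 / (n : ℝ) * (n * (L * ‖x - y‖)) := by
        gcongr
    _ = L * ‖x - y‖ := by field_simp

/-- Adding the strong convexity inequalities between 0 and a unit vector z gives μ ≤ ⟨∇f(z) - ∇f(0),
z⟩ ≤ L. A unit vector exists because `d` is positive. -/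
lemma StronglyConvexSmooth.le (hn : 0 < n) (hd : 0 < d) (hf : StronglyConvexSmooth μ L f) :
    μ ≤ L := by
  let z : Vec d := EuclideanSpace.single ⟨0, hd⟩ 1
  have hz : ‖z‖ = 1 := by simp [z]
  have h1 := hf.strongly_convex z 0
  have h2 := hf.strongly_convex 0 z
  have h3 := norm_gradient_globalObjective_sub_le hn hf z 0
  have h4 := real_inner_le_norm (∇ (globalObjective f) z - ∇ (globalObjective f) 0) z
  rw [inner_sub_left] at h4
  simp only [sub_zero, zero_sub, norm_neg, inner_neg_right, hz, mul_one] at *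
  linarith

lemma gradient_eq_zero_of_isMinOn {F : Type*} [NormedAddCommGroup F] [InnerProductSpace ℝ F]
    [CompleteSpace F] {g : F → ℝ} {z : F} (h : IsMinOn g Set.univ z) :
    ∇ g z = 0 := by
  have := (h.isLocalMin Filter.univ_mem).fderiv_eq_zero
  simp [gradient, this]

end Objective

/-! ### The inner loop -/

/-- A trajectory of the inner loop of gradient tracking with step size `α`. -/
structure IsTrackingLoop {n d : ℕ} (α : ℝ) (f : Fin n → Vec d → ℝ) (x y : ℕ → Stacked n d) :
    Prop where
  step_x : ∀ j, x (j + 1) = x j - α • y j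
  step_y : ∀ j, y (j + 1) = y j + stackedGradient f (x (j + 1)) - stackedGradient f (x j)
  average_y : average (y 0) = average (stackedGradient f (x 0))

section InnerLoop

variable {n d : ℕ} {μ L α : ℝ} {f : Fin n → Vec d → ℝ} {x y : ℕ → Stacked n d} {xstar : Vec d}

/-- The combination of the three errors that bounds the norm of the tracking variable. -/
noncomputable def trackingBound (L : ℝ) (xstar : Vec d) (x y : Stacked n d) : ℝ :=
  ‖y - stackedAverage y‖ + L * ‖x - stackedAverage x‖ + √(n : ℝ) * L * ‖average x - xstar‖

lemma trackingBound_nonneg (hL : 0 ≤ L) (x y : Stacked n d) : 0 ≤ trackingBound L xstar x y := by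
  unfold trackingBound; positivity

namespace IsTrackingLoop

variable (h : IsTrackingLoop α f x y)
include h

lemma y_eq (j : ℕ) : y j = y 0 + (stackedGradient f (x j) - stackedGradient f (x 0)) := by
  induction j with
  | zero => simp
  | succ j ih => rw [h.step_y, ih]; abel

lemma average_y_eq (j : ℕ) : average (y j) = average (stackedGradient f (x j)) := by
  rw [h.y_eq, average_add, average_sub, h.average_y]; abel

end IsTrackingLoop

lemma sqrt_mul_norm_average_gradient_le (hn : 0 < n) (hL : 0 ≤ L)
    (hf : StronglyConvexSmooth μ L f) (x : Stacked n d) :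
    √(n : ℝ) * ‖average (stackedGradient f x) - ∇ (globalObjective f) (average x)‖
      ≤ L * ‖x - stackedAverage x‖ := by
  rw [← average_stackedGradient_stackedAverage hf, ← average_sub]
  exact (sqrt_mul_norm_average_le hn _).trans (norm_stackedGradient_sub_le hL hf _ _)

/-- Split y into its deviation and its average. The average differs from the gradient at x̄ by the
consensus error of x, and that gradient is compared with the zero gradient at the minimizer. -/
lemma norm_le_trackingBound (hn : 0 < n) (hL : 0 ≤ L) (hf : StronglyConvexSmooth μ L f)
    (hmin : IsMinOn (globalObjective f) Set.univ xstar) {x y : Stacked n d}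
    (hxy : average y = average (stackedGradient f x)) :
    ‖y‖ ≤ trackingBound L xstar x y := by
  have h1 : ‖y‖ ≤ ‖y - stackedAverage y‖ + ‖stackedAverage y‖ := by
    simpa using norm_add_le (y - stackedAverage y) (stackedAverage y)
  rw [norm_stackedAverage, hxy] at h1
  have h2 := sqrt_mul_norm_average_gradient_le hn hL hf x
  have h3 := norm_gradient_globalObjective_sub_le hn hf (average x) xstar
  rw [gradient_eq_zero_of_isMinOn hmin, sub_zero] at h3
  have h4 : ‖average (stackedGradient f x)‖
      ≤ ‖average (stackedGradient f x) - ∇ (globalObjective f) (average x)‖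
        + ‖∇ (globalObjective f) (average x)‖ := by
    simpa using norm_add_le (average (stackedGradient f x) - ∇ (globalObjective f) (average x))
      (∇ (globalObjective f) (average x))
  have h5 := mul_le_mul_of_nonneg_left (h4.trans (add_le_add_right h3 _)) (Real.sqrt_nonneg n)
  unfold trackingBound
  linarith

namespace IsTrackingLoop

variable (h : IsTrackingLoop α f x y) (hn : 0 < n) (hL : 0 ≤ L) (hα : 0 ≤ α)
  (hf : StronglyConvexSmooth μ L f)
include h hn hL hα hf

omit hα in
lemma consensus_y_le (j : ℕ) :
    ‖y j - stackedAverage (y j)‖ ≤ ‖y 0 - stackedAverage (y 0)‖ + L * ‖x j - x 0‖ := by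
  rw [h.y_eq, stackedAverage_add, add_sub_add_comm]
  refine (norm_add_le _ _).trans ?_
  gcongr
  exact (norm_sub_stackedAverage_le hn _).trans (norm_stackedGradient_sub_le hL hf _ _)

variable (hmin : IsMinOn (globalObjective f) Set.univ xstar)
include hmin

omit hα in
lemma norm_y_le (j : ℕ) : ‖y j‖ ≤ trackingBound L xstar (x 0) (y 0) + L * ‖x j - x 0‖ := by
  rw [h.y_eq]
  exact (norm_add_le _ _).trans (add_le_add (norm_le_trackingBound hn hL hf hmin h.average_y)
    (norm_stackedGradient_sub_le hL hf _ _))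

/-- A discrete Grönwall argument for e_{j+1} ≤ (1 + αL)e_j + αT. Its exponential solution is
replaced by the polynomial αj(1 + jαL)T, which the induction preserves because jαL ≤ 1. -/
lemma norm_sub_start_le (j : ℕ) (hj : j * (α * L) ≤ 1) :
    ‖x j - x 0‖ ≤ α * j * (1 + j * (α * L)) * trackingBound L xstar (x 0) (y 0) := by
  induction j with
  | zero => simp
  | succ j ih =>
    have hq : 0 ≤ α * L := by positivity
    push_cast at hj ⊢
    have hj' : j * (α * L) ≤ 1 := by nlinarith
    have ih := ih hj'
    have hT := trackingBound_nonneg (xstar := xstar) hL (x 0) (y 0)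
    have h1 : ‖x (j + 1) - x 0‖ ≤ ‖x j - x 0‖ + α * ‖y j‖ := by
      rw [h.step_x, sub_right_comm]
      refine (norm_sub_le _ _).trans ?_
      rw [norm_smul, Real.norm_of_nonneg hα]
    have h2 := mul_le_mul_of_nonneg_left (h.norm_y_le hn hL hf hmin j) hα
    set T := trackingBound L xstar (x 0) (y 0)
    calc ‖x (j + 1) - x 0‖ ≤ (1 + α * L) * ‖x j - x 0‖ + α * T := by linarith
      _ ≤ (1 + α * L) * (α * j * (1 + j * (α * L)) * T) + α * T := by gcongr
      _ = ((1 + α * L) * (j * (1 + j * (α * L))) + 1) * (α * T) := by ring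
      _ ≤ ((j + 1) * (1 + (j + 1) * (α * L))) * (α * T) := by
        gcongr
        nlinarith [mul_le_mul_of_nonneg_left hj' (by positivity : 0 ≤ j * (α * L))]
      _ = _ := by ring

lemma norm_sub_start_le' (j : ℕ) (hj : j * (α * L) ≤ 1) :
    ‖x j - x 0‖ ≤ 2 * α * j * trackingBound L xstar (x 0) (y 0) := by
  refine (h.norm_sub_start_le hn hL hα hf hmin j hj).trans ?_
  have hT := trackingBound_nonneg (xstar := xstar) hL (x 0) (y 0)
  refine mul_le_mul_of_nonneg_right ?_ hT
  nlinarith [mul_le_mul_of_nonneg_left hj (by positivity : 0 ≤ α * j)]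

lemma consensus_y_le' (j : ℕ) (hj : j * (α * L) ≤ 1) :
    ‖y j - stackedAverage (y j)‖ ≤ ‖y 0 - stackedAverage (y 0)‖
      + 2 * (α * L) * j * trackingBound L xstar (x 0) (y 0) := by
  have h1 := h.consensus_y_le hn hL hf j
  have h2 := mul_le_mul_of_nonneg_left (h.norm_sub_start_le' hn hL hα hf hmin j hj) hL
  linarith

/-- Sum the deviations of the y_i over i < j; the drift terms 2i add up to j(j - 1). -/
lemma consensus_x_le (j : ℕ) (hj : j * (α * L) ≤ 1) :
    ‖x j - stackedAverage (x j)‖ ≤ ‖x 0 - stackedAverage (x 0)‖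
      + α * (j * ‖y 0 - stackedAverage (y 0)‖
        + α * L * (j * (j - 1)) * trackingBound L xstar (x 0) (y 0)) := by
  induction j with
  | zero => simp
  | succ j ih =>
    have hq : 0 ≤ α * L := by positivity
    push_cast at hj ⊢
    have hj' : j * (α * L) ≤ 1 := by nlinarith
    have h1 : ‖x (j + 1) - stackedAverage (x (j + 1))‖ ≤ ‖x j - stackedAverage (x j)‖
        + α * ‖y j - stackedAverage (y j)‖ := by
      rw [h.step_x, stackedAverage_sub, stackedAverage_smul, sub_sub_sub_comm, ← smul_sub]
      refine (norm_sub_le _ _).trans ?_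
      rw [norm_smul, Real.norm_of_nonneg hα]
    have h2 := mul_le_mul_of_nonneg_left (h.consensus_y_le' hn hL hα hf hmin j hj') hα
    have := ih hj'
    linarith

omit hα in
lemma optimality_step (hα : 0 ≤ α) (hαL : α * L ≤ 1) (hαμ : α * μ < 1) (j : ℕ) :
    ‖average (x (j + 1)) - xstar‖ ≤ (1 - α * μ) * ‖average (x j) - xstar‖
      + α * L / √(n : ℝ) * ‖x j - stackedAverage (x j)‖ := by
  have hs : 0 < √(n : ℝ) := by positivity
  have h1 := norm_gradient_step_le hf.differentiable_globalObjective
    (norm_gradient_globalObjective_sub_le hn hf) hf.strongly_convex hα hαL hαμ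
    (average (x j)) xstar
  rw [gradient_eq_zero_of_isMinOn hmin, smul_zero, sub_zero] at h1
  have h2 := sqrt_mul_norm_average_gradient_le hn hL hf (x j)
  rw [h.step_x, average_sub, average_smul, h.average_y_eq]
  have e : average (x j) - α • average (stackedGradient f (x j)) - xstar
      = (average (x j) - α • ∇ (globalObjective f) (average (x j)) - xstar)
        - α • (average (stackedGradient f (x j)) - ∇ (globalObjective f) (average (x j))) := by
    module
  rw [e]
  refine (norm_sub_le _ _).trans (add_le_add h1 ?_)
  rw [norm_smul, Real.norm_of_nonneg hα, div_mul_eq_mul_div, le_div_iff₀ hs]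
  nlinarith

/-- Unrolling `optimality_step`, the initial consensus error meets a geometric sum, which produces
the factor κ(1 - (1 - αμ)^j). In the remaining terms the contraction is dropped: the sums of i and
i(i - 1) over i < j are j(j - 1)/2 and j(j - 1)(j - 2)/3. The consensus bound is needed only up to
index j - 1. -/
lemma optimality_le (hμ : 0 < μ) (hαL : α * L ≤ 1) (hαμ : α * μ < 1) (j : ℕ)
    (hj : (j - 1) * (α * L) ≤ 1) :
    ‖average (x j) - xstar‖ ≤ (1 - α * μ) ^ j * ‖average (x 0) - xstar‖
      + L / μ / √(n : ℝ) * (1 - (1 - α * μ) ^ j) * ‖x 0 - stackedAverage (x 0)‖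
      + α ^ 2 * L / √(n : ℝ) * (j * (j - 1) / 2 * ‖y 0 - stackedAverage (y 0)‖
        + α * L * (j * (j - 1) * (j - 2) / 3) * trackingBound L xstar (x 0) (y 0)) := by
  have hs : 0 < √(n : ℝ) := by positivity
  induction j with
  | zero => simp
  | succ j ih =>
    have hq : 0 ≤ α * L := by positivity
    push_cast at hj ⊢
    rw [add_sub_cancel_right] at hj
    have h1 := h.optimality_step hn hL hf hmin hα hαL hαμ j
    have h2 := mul_le_mul_of_nonneg_left (h.consensus_x_le hn hL hα hf hmin j hj)
      (by positivity : 0 ≤ α * L / √(n : ℝ))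
    have h3 := mul_le_mul_of_nonneg_left (ih (by linarith)) (by linarith : 0 ≤ 1 - α * μ)
    have hT := trackingBound_nonneg (xstar := xstar) hL (x 0) (y 0)
    set T := trackingBound L xstar (x 0) (y 0)
    set V := α ^ 2 * L / √(n : ℝ) * (j * (j - 1) / 2 * ‖y 0 - stackedAverage (y 0)‖
        + α * L * (j * (j - 1) * (j - 2) / 3) * T) with hV
    have hV0 : 0 ≤ V := by
      have e1 : (0 : ℝ) ≤ j * (j - 1) := by
        rcases j with _ | j
        · simp
        · push_cast; rw [add_sub_cancel_right]; positivity
      have e2 : (0 : ℝ) ≤ j * (j - 1) * (j - 2) := by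
        rcases j with _ | _ | j
        · simp
        · simp
        · refine mul_nonneg e1 ?_
          push_cast
          linarith [(Nat.cast_nonneg j : (0 : ℝ) ≤ j)]
      positivity
    have h4 : (1 - α * μ) * V ≤ V := by nlinarith [mul_nonneg (mul_nonneg hα hμ.le) hV0]
    -- Extracting αμ makes the geometric sum telescope.
    have e3 : α * L / √(n : ℝ) = α * μ * (L / μ / √(n : ℝ)) := by field_simp
    have e4 : α * L / √(n : ℝ) * ‖x 0 - stackedAverage (x 0)‖
        = α * μ * (L / μ / √(n : ℝ)) * ‖x 0 - stackedAverage (x 0)‖ := by rw [e3]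
    have e5 : α * L / √(n : ℝ) * (‖x 0 - stackedAverage (x 0)‖
        + α * (j * ‖y 0 - stackedAverage (y 0)‖ + α * L * (j * (j - 1)) * T))
        = α * μ * (L / μ / √(n : ℝ)) * ‖x 0 - stackedAverage (x 0)‖
          + α ^ 2 * L / √(n : ℝ) * (j * ‖y 0 - stackedAverage (y 0)‖
            + α * L * (j * (j - 1)) * T) := by
      rw [mul_add, e4]; ring
    rw [e5] at h2
    refine (h1.trans (add_le_add h3 h2)).trans ?_
    rw [mul_add]
    refine (add_le_add_left (add_le_add_right h4 _) _).trans (le_of_eq ?_)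
    rw [hV]
    ring

end IsTrackingLoop

end InnerLoop

/-! ### Nonnegative matrices -/

section Spectral

open Filter in
attribute [local instance] Matrix.linftyOpNormedRing Matrix.linftyOpNormedAlgebra in
/-- Gelfand's bound on the powers of a real matrix. -/
lemma exists_abs_pow_le {ι : Type*} [Fintype ι] [DecidableEq ι] [Nonempty ι] (M : Matrix ι ι ℝ)
    {ε : ℝ} (hε : 0 < ε) :
    ∃ C : ℝ, 0 < C ∧ ∀ (k : ℕ) (i j : ι), |(M ^ k) i j| ≤ C * (rho M + ε) ^ k := by
  set A : Matrix ι ι ℂ := M.map (algebraMap ℝ ℂ) with hA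
  have hpow : ∀ k, A ^ k = (M ^ k).map (algebraMap ℝ ℂ) := fun k =>
    (map_pow (algebraMap ℝ ℂ).mapMatrix M k).symm
  have hentry : ∀ (k : ℕ) (i j : ι), |(M ^ k) i j| ≤ ‖A ^ k‖ := by
    intro k i j
    rw [hpow, Matrix.linfty_opNorm_def]
    have h1 : ‖((M ^ k).map (algebraMap ℝ ℂ)) i j‖₊
        ≤ ∑ j, ‖((M ^ k).map (algebraMap ℝ ℂ)) i j‖₊ :=
      Finset.single_le_sum (f := fun j => ‖((M ^ k).map (algebraMap ℝ ℂ)) i j‖₊)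
        (fun _ _ => zero_le) (Finset.mem_univ j)
    have h2 := h1.trans (Finset.le_sup (f := fun i =>
      ∑ j, ‖((M ^ k).map (algebraMap ℝ ℂ)) i j‖₊) (Finset.mem_univ i))
    have h3 := NNReal.coe_le_coe.2 h2
    simpa using h3
  have hfin : spectralRadius ℂ A ≠ ⊤ :=
    ne_top_of_le_ne_top ENNReal.coe_ne_top (spectrum.spectralRadius_le_nnnorm A)
  have hr : 0 ≤ rho M := ENNReal.toReal_nonneg
  have hlt : spectralRadius ℂ A < ENNReal.ofReal (rho M + ε) := by
    rw [ENNReal.lt_ofReal_iff_toReal_lt hfin]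
    exact lt_add_of_pos_right _ hε
  have hev := (spectrum.pow_norm_pow_one_div_tendsto_nhds_spectralRadius A).eventually
    (gt_mem_nhds hlt)
  obtain ⟨N, hN⟩ := eventually_atTop.1 hev
  have hpos : 0 < rho M + ε := by linarith
  -- Starting at N + 1 keeps `k` nonzero, so the k-th root can be undone. The smaller powers are
  -- absorbed into the constant below.
  have hbig : ∀ k, N + 1 ≤ k → ‖A ^ k‖ ≤ (rho M + ε) ^ k := by
    intro k hk
    have h1 := ((ENNReal.ofReal_lt_ofReal_iff hpos).1 (hN k (by omega))).le
    have hk0 : (k : ℝ) ≠ 0 := by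
      have : k ≠ 0 := by omega
      exact_mod_cast this
    calc ‖A ^ k‖ = (‖A ^ k‖ ^ (1 / (k : ℝ))) ^ k := by
          rw [← Real.rpow_natCast, ← Real.rpow_mul (norm_nonneg _), one_div_mul_cancel hk0,
            Real.rpow_one]
      _ ≤ (rho M + ε) ^ k := by gcongr
  refine ⟨1 + ∑ k ∈ Finset.range (N + 1), ‖A ^ k‖ / (rho M + ε) ^ k, by positivity, ?_⟩
  intro k i j
  refine (hentry k i j).trans ?_
  rw [← div_le_iff₀ (by positivity)]
  by_cases hk : k < N + 1
  · have := Finset.single_le_sum (f := fun k => ‖A ^ k‖ / (rho M + ε) ^ k)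
      (fun k _ => by positivity) (Finset.mem_range.2 hk)
    linarith
  · have h1 : ‖A ^ k‖ / (rho M + ε) ^ k ≤ 1 := (div_le_one (by positivity)).2 (hbig k (by omega))
    have : 0 ≤ ∑ k ∈ Finset.range (N + 1), ‖A ^ k‖ / (rho M + ε) ^ k := by positivity
    linarith

attribute [local instance] Matrix.linftyOpNormedRing Matrix.linftyOpNormedAlgebra in
/-- A nonnegative matrix that strictly decreases a positive vector has spectral radius below `1`. -/
lemma rho_lt_one_of_mulVec_lt {ι : Type*} [Fintype ι] [DecidableEq ι] [Nonempty ι]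
    {M : Matrix ι ι ℝ} (hM : ∀ i j, 0 ≤ M i j) {v : ι → ℝ} (hv : ∀ i, 0 < v i)
    (hMv : ∀ i, M.mulVec v i < v i) : rho M < 1 := by
  set A : Matrix ι ι ℂ := M.map (algebraMap ℝ ℂ) with hA
  have h1 : spectralRadius ℂ A < ((1 : NNReal) : ENNReal) := by
    refine spectrum.spectralRadius_lt_of_forall_lt A fun z hz => ?_
    rw [spectrum.mem_iff, Matrix.isUnit_iff_isUnit_det, isUnit_iff_ne_zero, not_not,
      ← Matrix.exists_mulVec_eq_zero_iff] at hz
    obtain ⟨u, hu, hzu⟩ := hz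
    have heig : ∀ i, z * u i = ∑ j, (M i j : ℂ) * u j := by
      intro i
      have := congrFun hzu i
      rw [Matrix.sub_mulVec, Pi.sub_apply, Pi.zero_apply, sub_eq_zero, Algebra.algebraMap_eq_smul_one,
        Matrix.smul_mulVec, Matrix.one_mulVec] at this
      exact this
    -- Measure the eigenvector in the sup norm weighted by `v`; the strict decrease of `v` at a
    -- maximizing index forces ‖z‖ < 1.
    obtain ⟨i, -, hi⟩ := Finset.exists_max_image Finset.univ (fun i => ‖u i‖ / v i)
      Finset.univ_nonempty
    set c := ‖u i‖ / v i with hc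
    have hle : ∀ j, ‖u j‖ ≤ c * v j := fun j => (div_le_iff₀ (hv j)).1 (hi j (Finset.mem_univ j))
    have hc0 : 0 < c := by
      obtain ⟨j, hj⟩ := Function.ne_iff.1 hu
      have : 0 < ‖u j‖ := norm_pos_iff.2 hj
      exact pos_of_mul_pos_left (this.trans_le (hle j)) (hv j).le
    have hui : ‖u i‖ = c * v i := by rw [hc, div_mul_cancel₀ _ (hv i).ne']
    have h2 : ‖z‖ * (c * v i) < c * v i := by
      calc ‖z‖ * (c * v i) = ‖∑ j, (M i j : ℂ) * u j‖ := by rw [← heig, norm_mul, hui]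
        _ ≤ ∑ j, M i j * (c * v j) := by
          refine (norm_sum_le _ _).trans (Finset.sum_le_sum fun j _ => ?_)
          rw [norm_mul, Complex.norm_real, Real.norm_of_nonneg (hM i j)]
          exact mul_le_mul_of_nonneg_left (hle j) (hM i j)
        _ = c * M.mulVec v i := by
          simp only [Matrix.mulVec, dotProduct, Finset.mul_sum]
          exact Finset.sum_congr rfl fun j _ => by ring
        _ < c * v i := mul_lt_mul_of_pos_left (hMv i) hc0
    have h3 : ‖z‖ < 1 := by
      have := mul_pos hc0 (hv i)
      by_contra hcon
      nlinarith [not_lt.1 hcon]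
    exact_mod_cast h3
  unfold rho
  rw [← hA]
  have := (ENNReal.toReal_lt_toReal (ne_top_of_lt h1) ENNReal.coe_ne_top).2 h1
  simpa using this

/-- A nonnegative `3 × 3` matrix `M` has spectral radius below `1` if `I - M` dominates a matrix with
positive diagonal `c` and positive determinant. -/
lemma rho_lt_one_of_det_pos {M : Matrix (Fin 3) (Fin 3) ℝ} (hM : ∀ i j, 0 ≤ M i j)
    {c₀ c₁ c₂ : ℝ} (h₀ : 0 < c₀) (h₁ : 0 < c₁) (h₂ : 0 < c₂)
    (hc₀ : c₀ ≤ 1 - M 0 0) (hc₁ : c₁ ≤ 1 - M 1 1) (hc₂ : c₂ ≤ 1 - M 2 2)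
    (hdet : M 0 1 * M 1 2 * M 2 0 + M 0 2 * M 1 0 * M 2 1 + c₀ * (M 1 2 * M 2 1)
      + c₁ * (M 0 2 * M 2 0) + c₂ * (M 0 1 * M 1 0) < c₀ * c₁ * c₂) : rho M < 1 := by
  have p1 := mul_nonneg (mul_nonneg (hM 0 1) (hM 1 2)) (hM 2 0)
  have p2 := mul_nonneg (mul_nonneg (hM 0 2) (hM 1 0)) (hM 2 1)
  have q0 := mul_nonneg (hM 1 2) (hM 2 1)
  have q1 := mul_nonneg (hM 0 2) (hM 2 0)
  have q2 := mul_nonneg (hM 0 1) (hM 1 0)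
  -- All terms of `hdet` are nonnegative, so dropping all but one yields positivity of a 2 × 2
  -- principal minor.
  have r0 : M 1 2 * M 2 1 < c₁ * c₂ := by
    refine lt_of_mul_lt_mul_left ?_ h₀.le
    nlinarith [mul_nonneg h₁.le q1, mul_nonneg h₂.le q2]
  have r1 : M 0 2 * M 2 0 < c₀ * c₂ := by
    refine lt_of_mul_lt_mul_left ?_ h₁.le
    nlinarith [mul_nonneg h₀.le q0, mul_nonneg h₂.le q2]
  have r2 : M 0 1 * M 1 0 < c₀ * c₁ := by
    refine lt_of_mul_lt_mul_left ?_ h₂.le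
    nlinarith [mul_nonneg h₀.le q0, mul_nonneg h₁.le q1]
  have n01 := hM 0 1
  have n02 := hM 0 2
  have n10 := hM 1 0
  have n12 := hM 1 2
  have n20 := hM 2 0
  have n21 := hM 2 1
  -- The vector v is the adjugate, applied to (1, 1, 1), of the matrix with diagonal c and
  -- off-diagonal entries -M i j. That matrix therefore sends v to its positive determinant times
  -- (1, 1, 1).
  obtain ⟨v₀, e₀⟩ : ∃ v, v = c₁ * c₂ - M 1 2 * M 2 1 + (M 0 1 * c₂ + M 0 2 * M 2 1)
      + (M 0 1 * M 1 2 + M 0 2 * c₁) := ⟨_, rfl⟩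
  obtain ⟨v₁, e₁⟩ : ∃ v, v = M 1 0 * c₂ + M 1 2 * M 2 0 + (c₀ * c₂ - M 0 2 * M 2 0)
      + (c₀ * M 1 2 + M 0 2 * M 1 0) := ⟨_, rfl⟩
  obtain ⟨v₂, e₂⟩ : ∃ v, v = M 1 0 * M 2 1 + c₁ * M 2 0 + (c₀ * M 2 1 + M 0 1 * M 2 0)
      + (c₀ * c₁ - M 0 1 * M 1 0) := ⟨_, rfl⟩
  have hv₀ : 0 < v₀ := by
    have : 0 ≤ M 0 1 * c₂ + M 0 2 * M 2 1 + (M 0 1 * M 1 2 + M 0 2 * c₁) := by positivity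
    linarith
  have hv₁ : 0 < v₁ := by
    have : 0 ≤ M 1 0 * c₂ + M 1 2 * M 2 0 + (c₀ * M 1 2 + M 0 2 * M 1 0) := by positivity
    linarith
  have hv₂ : 0 < v₂ := by
    have : 0 ≤ M 1 0 * M 2 1 + c₁ * M 2 0 + (c₀ * M 2 1 + M 0 1 * M 2 0) := by positivity
    linarith
  have s₀ : M 0 1 * v₁ + M 0 2 * v₂ < c₀ * v₀ := by rw [e₀, e₁, e₂]; linarith
  have s₁ : M 1 0 * v₀ + M 1 2 * v₂ < c₁ * v₁ := by rw [e₀, e₁, e₂]; linarith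
  have s₂ : M 2 0 * v₀ + M 2 1 * v₁ < c₂ * v₂ := by rw [e₀, e₁, e₂]; linarith
  have t₀ := mul_le_mul_of_nonneg_right hc₀ hv₀.le
  have t₁ := mul_le_mul_of_nonneg_right hc₁ hv₁.le
  have t₂ := mul_le_mul_of_nonneg_right hc₂ hv₂.le
  refine rho_lt_one_of_mulVec_lt hM (v := ![v₀, v₁, v₂]) ?_ ?_
  · intro i
    fin_cases i
    exacts [hv₀, hv₁, hv₂]
  · intro i
    fin_cases i <;>
    simp only [Matrix.mulVec, dotProduct, Fin.sum_univ_three, Fin.zero_eta, Fin.mk_one,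
      Fin.reduceFinMk, Matrix.cons_val] <;>
    linarith

end Spectral

/-! ### The error recursion -/

namespace GTASetup

variable {n d : ℕ} (S : GTASetup n)

lemma isTrackingLoop {f : Fin n → Vec d → ℝ} {s : Stacked n d × Stacked n d}
    (hs : average s.2 = average (stackedGradient f s.1)) :
    IsTrackingLoop S.α f (fun j => ((S.innerStep f)^[j] s).1)
      (fun j => ((S.innerStep f)^[j] s).2) where
  step_x j := by simp only [Function.iterate_succ_apply', innerStep]
  step_y j := by simp only [Function.iterate_succ_apply', innerStep]
  average_y := hs

section Recursion

variable {S} {f : Fin n → Vec d → ℝ} {xstar : Vec d} {s : Stacked n d × Stacked n d}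
  (hn : 0 < n) (hng : 1 ≤ S.ng) (hnc : 1 ≤ S.nc) (hμ : 0 < S.μ) (hL : 0 ≤ S.L) (hα : 0 ≤ S.α)
  (hαL : S.α * S.L * S.ng ≤ 1) (hαμ : S.α * S.μ < 1)
  (hf : StronglyConvexSmooth S.μ S.L f)
  (hmin : IsMinOn (globalObjective f) Set.univ xstar)
  (hs : average s.2 = average (stackedGradient f s.1))

/-- Communication preserves averages, so on averages the final step is just one more inner step:
`ng` gradient steps in all. -/
lemma average_outerStep_fst (hW₁ : S.W₁ ∈ doublyStochastic ℝ (Fin n))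
    (hW₂ : S.W₂ ∈ doublyStochastic ℝ (Fin n)) (hng : 1 ≤ S.ng) :
    average (S.outerStep f s).1 = average ((S.innerStep f)^[S.ng] s).1 := by
  obtain ⟨g, hg⟩ := Nat.exists_eq_add_of_le' hng
  rw [hg, Function.iterate_succ_apply']
  simp only [outerStep, commStep, innerStep, average_sub, average_smul, average_act_pow hW₁,
    average_act_pow hW₂, hg, Nat.add_sub_cancel]

include hs in
lemma average_outerStep_snd (hW₃ : S.W₃ ∈ doublyStochastic ℝ (Fin n))
    (hW₄ : S.W₄ ∈ doublyStochastic ℝ (Fin n)) :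
    average (S.outerStep f s).2 = average (stackedGradient f (S.outerStep f s).1) := by
  have h := (S.isTrackingLoop hs).average_y_eq (S.ng - 1)
  simp only [outerStep, commStep, average_add, average_act_pow hW₃, average_act_pow hW₄,
    average_sub] at h ⊢
  rw [h]
  abel

include hng hα hαL hL in
lemma inner_steps_mul_le : ((S.ng - 1 : ℕ) : ℝ) * (S.α * S.L) ≤ 1 := by
  rw [Nat.cast_pred hng]
  nlinarith [mul_nonneg hα hL]

include hn hng hμ hL hα hαL hαμ hf hmin hs in
lemma optimality_outerStep_le (hW₁ : S.W₁ ∈ doublyStochastic ℝ (Fin n))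
    (hW₂ : S.W₂ ∈ doublyStochastic ℝ (Fin n)) :
    ‖average (S.outerStep f s).1 - xstar‖ ≤ (1 - S.α * S.μ) ^ S.ng * ‖average s.1 - xstar‖
      + S.L / S.μ / √(n : ℝ) * (1 - (1 - S.α * S.μ) ^ S.ng) * ‖s.1 - stackedAverage s.1‖
      + S.α ^ 2 * S.L / √(n : ℝ) * (S.ng * (S.ng - 1) * trackingBound S.L xstar s.1 s.2) := by
  have hq : 0 ≤ S.α * S.L := by positivity
  have hm : (1 : ℝ) ≤ S.ng := by exact_mod_cast hng
  rw [average_outerStep_fst hW₁ hW₂ hng]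
  refine ((S.isTrackingLoop hs).optimality_le hn hL hα hf hmin hμ (by nlinarith) hαμ S.ng
    (by nlinarith)).trans ?_
  gcongr _ + _ * ?_
  simp only [Function.iterate_zero, id]
  have hT := trackingBound_nonneg (xstar := xstar) hL s.1 s.2
  have hY : ‖s.2 - stackedAverage s.2‖ ≤ trackingBound S.L xstar s.1 s.2 := by
    have : 0 ≤ S.L * ‖s.1 - stackedAverage s.1‖ + √(n : ℝ) * S.L * ‖average s.1 - xstar‖ := by
      positivity
    unfold trackingBound
    linarith
  have hmg : (0 : ℝ) ≤ S.ng * (S.ng - 1) := mul_nonneg (by linarith) (by linarith)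
  have h1 := mul_le_mul_of_nonneg_left hY hmg
  -- With this the coefficients 1/2 and 1/3 from `optimality_le` combine to at most 1.
  have h2 : S.α * S.L * (S.ng - 2) ≤ 1 := by linarith
  have h3 := mul_le_mul_of_nonneg_left h2 (mul_nonneg hmg hT)
  have h4 := mul_nonneg hmg hT
  linarith

include hn hng hnc hL hα hαL hf hmin hs in
lemma consensus_x_outerStep_le (hW₁ : S.W₁ ∈ doublyStochastic ℝ (Fin n))
    (hW₂ : S.W₂ ∈ doublyStochastic ℝ (Fin n)) :
    ‖(S.outerStep f s).1 - stackedAverage (S.outerStep f s).1‖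
      ≤ S.β₁ ^ S.nc * ‖s.1 - stackedAverage s.1‖
        + S.α * ((S.ng - 1) * S.β₁ ^ S.nc + S.β₂ ^ S.nc) * ‖s.2 - stackedAverage s.2‖
        + S.α * S.L * (S.ng - 1) * (S.α * S.δ₁) * trackingBound S.L xstar s.1 s.2 := by
  have hj := inner_steps_mul_le hng hL hα hαL
  have hx := (S.isTrackingLoop hs).consensus_x_le hn hL hα hf hmin _ hj
  have hy := (S.isTrackingLoop hs).consensus_y_le' hn hL hα hf hmin _ hj
  simp only [Function.iterate_zero, id, Nat.cast_pred hng] at hx hy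
  have h1 := norm_act_pow_sub_stackedAverage_le hn hW₁ hnc ((S.innerStep f)^[S.ng - 1] s).1
  have h2 := norm_act_pow_sub_stackedAverage_le hn hW₂ hnc ((S.innerStep f)^[S.ng - 1] s).2
  have hβ₁ : 0 ≤ S.β₁ ^ S.nc := pow_nonneg (norm_nonneg _) _
  have hβ₂ : 0 ≤ S.β₂ ^ S.nc := pow_nonneg (norm_nonneg _) _
  have h1' := h1.trans (mul_le_mul_of_nonneg_left hx hβ₁)
  have h2' := mul_le_mul_of_nonneg_left (h2.trans (mul_le_mul_of_nonneg_left hy hβ₂)) hα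
  simp only [outerStep, commStep]
  rw [stackedAverage_sub, stackedAverage_smul, sub_sub_sub_comm, ← smul_sub]
  refine (norm_sub_le _ _).trans ?_
  rw [norm_smul, Real.norm_of_nonneg hα]
  refine (add_le_add h1' h2').trans (le_of_eq ?_)
  rw [← show S.β₁ = specNorm (S.W₁ - averagingMatrix n) from rfl,
    ← show S.β₂ = specNorm (S.W₂ - averagingMatrix n) from rfl]
  -- At j = ng - 1 the coefficients β₁^nc j(j - 1) and 2β₂^nc j of T add up to (ng - 1)δ₁.
  rw [δ₁]
  ring

include hn hng hnc hL hα hαL hf hmin hs in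
lemma consensus_y_outerStep_le (hW₁ : S.W₁ ∈ doublyStochastic ℝ (Fin n))
    (hW₂ : S.W₂ ∈ doublyStochastic ℝ (Fin n)) (hW₃ : S.W₃ ∈ doublyStochastic ℝ (Fin n))
    (hW₄ : S.W₄ ∈ doublyStochastic ℝ (Fin n)) :
    ‖(S.outerStep f s).2 - stackedAverage (S.outerStep f s).2‖
      ≤ S.β₄ ^ S.nc * S.L * S.ζ d * ‖s.1 - stackedAverage s.1‖
        + S.β₃ ^ S.nc * ‖s.2 - stackedAverage s.2‖
        + (S.α * S.β₄ ^ S.nc * S.L + S.α * S.L * (S.ng - 1) * S.δ₂ d)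
          * trackingBound S.L xstar s.1 s.2 := by
  have hj := inner_steps_mul_le hng hL hα hαL
  have hm : (1 : ℝ) ≤ S.ng := by exact_mod_cast hng
  have hq : 0 ≤ S.α * S.L := by positivity
  have hx := (S.isTrackingLoop hs).consensus_x_le hn hL hα hf hmin _ hj
  have hy := (S.isTrackingLoop hs).consensus_y_le' hn hL hα hf hmin _ hj
  have hyn := (S.isTrackingLoop hs).norm_y_le hn hL hf hmin (S.ng - 1)
  have hD := (S.isTrackingLoop hs).norm_sub_start_le' hn hL hα hf hmin _ hj
  simp only [Function.iterate_zero, id, Nat.cast_pred hng] at hx hy hyn hD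
  have hβ₃ : 0 ≤ S.β₃ ^ S.nc := pow_nonneg (norm_nonneg _) _
  have hβ₄ : 0 ≤ S.β₄ ^ S.nc := pow_nonneg (norm_nonneg _) _
  have hζ : 0 ≤ S.ζ d := norm_nonneg _
  set t := (S.innerStep f)^[S.ng - 1] s with ht
  have h3 := (norm_act_pow_sub_stackedAverage_le hn hW₃ hnc t.2).trans
    (mul_le_mul_of_nonneg_left hy hβ₃)
  have hmove : ‖(S.outerStep f s).1 - t.1‖ ≤ S.ζ d * ‖t.1 - stackedAverage t.1‖
      + S.α * ‖t.2‖ := by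
    simp only [outerStep, commStep, ← ht]
    rw [sub_right_comm]
    refine (norm_sub_le _ _).trans (add_le_add (norm_act_pow_sub_self_le hW₁ _ _) ?_)
    rw [norm_smul, Real.norm_of_nonneg hα]
    exact mul_le_mul_of_nonneg_left (norm_act_pow_le hW₂ _ _) hα
  have hT := trackingBound_nonneg (xstar := xstar) hL s.1 s.2
  have hY : ‖s.2 - stackedAverage s.2‖ ≤ trackingBound S.L xstar s.1 s.2 := by
    have : 0 ≤ S.L * ‖s.1 - stackedAverage s.1‖ + √(n : ℝ) * S.L * ‖average s.1 - xstar‖ := by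
      positivity
    unfold trackingBound
    linarith
  set T := trackingBound S.L xstar s.1 s.2
  have hx2 : ‖t.1 - stackedAverage t.1‖ ≤ ‖s.1 - stackedAverage s.1‖
      + 2 * S.α * (S.ng - 1) * T := by
    have h1 : S.α * S.L * (S.ng - 2) ≤ 1 := by linarith
    have h2 := mul_le_mul_of_nonneg_left h1
      (mul_nonneg (mul_nonneg hα (by linarith : (0 : ℝ) ≤ S.ng - 1)) hT)
    have h3 := mul_le_mul_of_nonneg_left hY
      (mul_nonneg hα (by linarith : (0 : ℝ) ≤ S.ng - 1))
    linarith
  -- Using αL ≤ 1/ng here is the source of the summand β₄^nc/ng in δ₂.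
  have hy2 : ‖t.2‖ ≤ T + 2 * ((S.ng - 1) / S.ng) * T := by
    have h1 : S.α * S.L ≤ 1 / S.ng := by rw [le_div_iff₀ (by linarith)]; exact hαL
    have h2 := mul_le_mul_of_nonneg_right h1
      (mul_nonneg (by linarith : (0 : ℝ) ≤ S.ng - 1) hT)
    have h3 := mul_le_mul_of_nonneg_left hD hL
    have h4 : 1 / (S.ng : ℝ) * ((S.ng - 1) * T) = (S.ng - 1) / S.ng * T := by ring
    linarith
  have h4 : ‖act (liftMatrix d S.W₄ ^ S.nc) (stackedGradient f (S.outerStep f s).1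
        - stackedGradient f t.1) - stackedAverage (act (liftMatrix d S.W₄ ^ S.nc)
          (stackedGradient f (S.outerStep f s).1 - stackedGradient f t.1))‖
      ≤ S.β₄ ^ S.nc * (S.L * (S.ζ d * (‖s.1 - stackedAverage s.1‖ + 2 * S.α * (S.ng - 1) * T)
        + S.α * (T + 2 * ((S.ng - 1) / S.ng) * T))) := by
    refine (norm_act_pow_sub_stackedAverage_le hn hW₄ hnc _).trans ?_
    refine mul_le_mul_of_nonneg_left ?_ hβ₄
    refine (norm_sub_stackedAverage_le hn _).trans ?_
    refine (norm_stackedGradient_sub_le hL hf _ _).trans ?_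
    gcongr
    refine hmove.trans ?_
    gcongr
  have e : (S.outerStep f s).2 = act (liftMatrix d S.W₃ ^ S.nc) t.2
      + act (liftMatrix d S.W₄ ^ S.nc) (stackedGradient f (S.outerStep f s).1
        - stackedGradient f t.1) := rfl
  rw [e, stackedAverage_add, add_sub_add_comm]
  refine ((norm_add_le _ _).trans (add_le_add h3 h4)).trans (le_of_eq ?_)
  rw [← show S.β₃ = specNorm (S.W₃ - averagingMatrix n) from rfl, δ₂]
  ring

end Recursion

end GTASetup

/-! ### Scalar inequalities behind the step size bound -/

/-- Second-order companion to Bernoulli's inequality. It bounds the first diagonal entry of B away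
from 1. -/
lemma one_sub_pow_le {x : ℝ} (h0 : 0 ≤ x) (h1 : x ≤ 1) (m : ℕ) :
    (1 - x) ^ m ≤ 1 - m * x + m * (m - 1) / 2 * x ^ 2 := by
  induction m with
  | zero => simp
  | succ m ih =>
    have hm : (0 : ℝ) ≤ m * (m - 1) := by
      rcases m with _ | m
      · simp
      · push_cast; rw [add_sub_cancel_right]; positivity
    have := mul_le_mul_of_nonneg_right ih (sub_nonneg.2 h1)
    rw [pow_succ]
    push_cast
    nlinarith [mul_nonneg hm (pow_nonneg h0 3)]

lemma quadratic_lt_of_lt_root {a b₁ b₂ b₃ : ℝ} (ha : 0 < a) (h₁ : 0 ≤ b₁) (h₂ : 0 ≤ b₂)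
    (h : a < (-b₂ + √(b₂ ^ 2 + 4 * b₁ * b₃)) / (2 * b₁)) : b₁ * a ^ 2 + b₂ * a < b₃ := by
  -- If b₁ were 0, the quotient would be 0 by convention, contradicting 0 < a.
  have hb : 0 < b₁ := by
    refine lt_of_le_of_ne h₁ fun hb => ?_
    rw [← hb] at h
    simp at h
    linarith
  rw [lt_div_iff₀ (by linarith)] at h
  have h3 : a * (2 * b₁) + b₂ < √(b₂ ^ 2 + 4 * b₁ * b₃) := by linarith
  rw [Real.lt_sqrt (by positivity)] at h3
  refine lt_of_mul_lt_mul_left ?_ hb.le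
  nlinarith

/-- The polynomial inequality behind the step size condition. Here `D` stands for `g δ₁`, and the
`Bᵢⱼ` for the off-diagonal entries of the matrix governing the error recursion. -/
lemma det_pos_of_step_size {a μ L m g s β₄ D P Q c₁ c₃ b₁ b₂ B₁₂ B₁₃ B₂₁ B₂₃ B₃₁ B₃₂ : ℝ}
    (ha : 0 < a) (hμ : 0 < μ) (hL : 0 < L) (hm : 1 ≤ m) (hg : g = m - 1) (hs : 0 < s)
    (hβ₄ : 0 ≤ β₄) (hD : 0 ≤ D) (hP : 0 ≤ P) (hQ : β₄ ≤ Q) (hc₁ : 0 < c₁) (hc₃ : 0 < c₃)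
    (haL : a * L * m ≤ 1)
    (hb₁ : μ * L ^ 2 * m / 2 * P * Q + L ^ 3 * m * (D * c₃ + g * (Q * c₁))
      + L ^ 2 * g * (L * D * (2 * β₄ + Q)) + L ^ 2 * Q * (L * m) * P ≤ b₁)
    (hb₂ : μ * m * β₄ * L * P ≤ b₂)
    (hb : b₁ * a ^ 2 + b₂ * a < μ * m / 2 * c₁ * c₃)
    (h₁₂ : B₁₂ ≤ 2 * (L * m * a) / s) (h₁₃ : B₁₃ ≤ a ^ 2 * L * m * g / s)
    (h₂₁ : B₂₁ ≤ s * (a ^ 2 * L ^ 2 * D)) (h₂₃ : B₂₃ ≤ a * P)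
    (h₃₁ : B₃₁ ≤ s * (a * L ^ 2 * Q)) (h₃₂ : B₃₂ ≤ 2 * β₄ * L + a * L ^ 2 * Q)
    (n₂₁ : 0 ≤ B₂₁) (n₂₃ : 0 ≤ B₂₃) (n₃₁ : 0 ≤ B₃₁)
    (n₃₂ : 0 ≤ B₃₂) :
    B₁₂ * B₂₃ * B₃₁ + B₁₃ * B₂₁ * B₃₂ + m * a * μ / 2 * (B₂₃ * B₃₂) + 2 * c₁ * (B₁₃ * B₃₁)
      + c₃ * (B₁₂ * B₂₁) < m * a * μ / 2 * (2 * c₁) * c₃ := by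
  have hg0 : 0 ≤ g := by linarith
  have hQ0 : 0 ≤ Q := hβ₄.trans hQ
  have haL0 : 0 ≤ a * L := by positivity
  have haL1 : a * L ≤ 1 := by nlinarith
  -- Each of the five terms is at most 2a times a part of b₁a² + b₂a, and the right side of the goal
  -- is 2a · μm/2 · c₁c₃. The factors s cancel in every product. In `t2` the condition aLm ≤ 1
  -- lowers the degree in a.
  have t1 : B₁₂ * B₂₃ * B₃₁ ≤ 2 * a * (a ^ 2 * (L ^ 2 * Q * (L * m) * P)) := by
    calc B₁₂ * B₂₃ * B₃₁ ≤ 2 * (L * m * a) / s * (a * P) * (s * (a * L ^ 2 * Q)) := by gcongr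
      _ = _ := by field_simp
  have t2 : B₁₃ * B₂₁ * B₃₂ ≤ a * (a ^ 2 * (L ^ 2 * g * (L * D * (2 * β₄ + Q)))) := by
    calc B₁₃ * B₂₁ * B₃₂
        ≤ a ^ 2 * L * m * g / s * (s * (a ^ 2 * L ^ 2 * D)) * (2 * β₄ * L + a * L ^ 2 * Q) := by
          gcongr
      _ = (a * L * m) * (a ^ 3 * L ^ 2 * g * D * (2 * β₄ * L + (a * L) * (L * Q))) := by
          field_simp
      _ ≤ 1 * (a ^ 3 * L ^ 2 * g * D * (2 * β₄ * L + 1 * (L * Q))) := by gcongr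
      _ = _ := by ring
  have t3 : m * a * μ / 2 * (B₂₃ * B₃₂)
      ≤ a * (a * (μ * m * β₄ * L * P)) + a * (a ^ 2 * (μ * L ^ 2 * m / 2 * P * Q)) := by
    calc m * a * μ / 2 * (B₂₃ * B₃₂)
        ≤ m * a * μ / 2 * ((a * P) * (2 * β₄ * L + a * L ^ 2 * Q)) := by gcongr
      _ = _ := by ring
  have t4 : 2 * c₁ * (B₁₃ * B₃₁) ≤ 2 * a * (a ^ 2 * (L ^ 3 * m * (g * (Q * c₁)))) := by
    calc 2 * c₁ * (B₁₃ * B₃₁)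
        ≤ 2 * c₁ * (a ^ 2 * L * m * g / s * (s * (a * L ^ 2 * Q))) := by gcongr
      _ = _ := by field_simp
  have t5 : c₃ * (B₁₂ * B₂₁) ≤ 2 * a * (a ^ 2 * (L ^ 3 * m * (D * c₃))) := by
    calc c₃ * (B₁₂ * B₂₁) ≤ c₃ * (2 * (L * m * a) / s * (s * (a ^ 2 * L ^ 2 * D))) := by gcongr
      _ = _ := by field_simp
  have p2 : 0 ≤ a * (a ^ 2 * (L ^ 2 * g * (L * D * (2 * β₄ + Q)))) := by positivity
  have p3 : 0 ≤ a * (a * (μ * m * β₄ * L * P)) := by positivity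
  have p3' : 0 ≤ a * (a ^ 2 * (μ * L ^ 2 * m / 2 * P * Q)) := by positivity
  have k1 := mul_le_mul_of_nonneg_left hb₁ (by positivity : 0 ≤ 2 * a * a ^ 2)
  have k2 := mul_le_mul_of_nonneg_left hb₂ (by positivity : 0 ≤ 2 * a * a)
  have k3 := mul_lt_mul_of_pos_left hb (by positivity : 0 < 2 * a)
  linarith

/-! ### Step size condition, contractivity of B, and the recursion for r_k -/

namespace GTASetup

variable {n d : ℕ} {S : GTASetup n}

lemma step_lt_of_lt_stepBound (hL : 0 < S.L) (hμ : 0 < S.μ) (hα : 0 < S.α) (hng : 1 ≤ S.ng)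
    (hδ₂ : 0 ≤ S.δ₂ d) (h : (S.α : EReal) < S.stepBound d) :
    S.α * S.L * S.ng < 1 ∧
    S.α * (2 * S.L ^ 2 + S.μ ^ 2) * ((S.ng : ℝ) - 1) ≤ S.μ ∧
    4 * S.α * S.L * (S.β₄ ^ S.nc + ((S.ng : ℝ) - 1) * S.δ₂ d) < 3 * (1 - S.β₃ ^ S.nc) ∧
    S.α < (-S.b₂ + √(S.b₂ ^ 2 + 4 * S.b₁ d * S.b₃)) / (2 * S.b₁ d) := by
  have hm : (1 : ℝ) ≤ S.ng := by exact_mod_cast hng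
  unfold stepBound at h
  simp only [lt_inf_iff, EReal.coe_lt_coe_iff] at h
  obtain ⟨⟨⟨⟨h1, h2⟩, -⟩, h4⟩, h5⟩ := h
  refine ⟨?_, ?_, ?_, h5⟩
  · rw [lt_div_iff₀ (by positivity)] at h1
    linarith
  · by_cases hg : S.ng = 1
    · rw [hg]
      simpa using hμ.le
    · have hg' : (0 : ℝ) < (S.ng : ℝ) - 1 := by
        have : (1 : ℝ) < S.ng := by exact_mod_cast lt_of_le_of_ne hng (Ne.symm hg)
        linarith
      rw [if_neg hg, EReal.coe_lt_coe_iff, lt_div_iff₀ (by positivity)] at h2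
      linarith
  · have hβ₄ : 0 ≤ S.β₄ ^ S.nc := pow_nonneg (norm_nonneg _) _
    have hQ : 0 ≤ S.β₄ ^ S.nc + S.δ₂ d * ((S.ng : ℝ) - 1) :=
      add_nonneg hβ₄ (mul_nonneg hδ₂ (by linarith))
    rcases hQ.eq_or_lt with h0 | h0
    · rw [← h0, mul_zero, div_zero] at h4
      exact absurd h4 hα.le.not_gt
    · rw [lt_div_iff₀ (by positivity)] at h4
      linarith

lemma δ₂_nonneg (d : ℕ) : 0 ≤ S.δ₂ d := by
  have h3 : 0 ≤ S.β₃ ^ S.nc := pow_nonneg (norm_nonneg _) _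
  have h4 : 0 ≤ S.β₄ ^ S.nc := pow_nonneg (norm_nonneg _) _
  have hζ : 0 ≤ S.ζ d := norm_nonneg _
  unfold δ₂
  positivity

/-- The factor ng - 1 matters: for ng = 1 the number δ₁ = 2β₂^nc - β₁^nc may be negative. -/
lemma mul_δ₁_nonneg (hng : 1 ≤ S.ng) : 0 ≤ ((S.ng : ℝ) - 1) * S.δ₁ := by
  have h1 : 0 ≤ S.β₁ ^ S.nc := pow_nonneg (norm_nonneg _) _
  have h2 : 0 ≤ S.β₂ ^ S.nc := pow_nonneg (norm_nonneg _) _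
  rcases hng.eq_or_lt with h | h
  · simp [← h]
  · have : (2 : ℝ) ≤ S.ng := by exact_mod_cast h
    refine mul_nonneg (by linarith) ?_
    unfold δ₁
    have := mul_nonneg h1 (sub_nonneg.2 this)
    positivity

set_option maxHeartbeats 800000 in
/-- Under the step size condition the error recursion is contractive. -/
lemma rho_matB_lt_one (hn : 0 < n) (hW₁ : S.W₁ ∈ doublyStochastic ℝ (Fin n))
    (hμ : 0 < S.μ) (hL : 0 < S.L) (hα : 0 < S.α) (hnc : 1 ≤ S.nc) (hng : 1 ≤ S.ng)
    (hB : ∀ i j, 0 ≤ S.matB d i j) (hβ₁ : S.β₁ < 1) (hβ₃ : S.β₃ < 1) (hμL : S.μ ≤ S.L)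
    (hstep : (S.α : EReal) < S.stepBound d) : rho (S.matB d) < 1 := by
  have hm : (1 : ℝ) ≤ S.ng := by exact_mod_cast hng
  have hs : 0 < √(n : ℝ) := by positivity
  have hδ₂ := S.δ₂_nonneg d
  have hD := S.mul_δ₁_nonneg hng
  obtain ⟨h1, h2, h4, h5⟩ := step_lt_of_lt_stepBound hL hμ hα hng hδ₂ hstep
  have hαL : 0 ≤ S.α * S.L := by positivity
  have hαL1 : S.α * S.L ≤ 1 := by linarith [mul_le_mul_of_nonneg_left hm hαL]
  have hαμ0 : 0 ≤ S.α * S.μ := by positivity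
  have hαμ : S.α * S.μ ≤ 1 := by linarith [mul_le_mul_of_nonneg_left hμL hα.le]
  have hαLg : S.α * S.L * ((S.ng : ℝ) - 1) ≤ 1 := by linarith
  have p1 : 0 ≤ S.β₁ ^ S.nc := pow_nonneg (norm_nonneg _) _
  have p2 : 0 ≤ S.β₂ ^ S.nc := pow_nonneg (norm_nonneg _) _
  have p4 : 0 ≤ S.β₄ ^ S.nc := pow_nonneg (norm_nonneg _) _
  have q1 : S.β₁ ^ S.nc < 1 := pow_lt_one₀ (norm_nonneg _) hβ₁ (by omega)
  have q3 : S.β₃ ^ S.nc < 1 := pow_lt_one₀ (norm_nonneg _) hβ₃ (by omega)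
  have hζ : S.ζ d ≤ 2 := specNorm_lift_pow_sub_one_le hW₁ _
  have e00 : S.matB d 0 0 = (1 - S.α * S.μ) ^ S.ng
      + S.α * S.L * ((S.ng : ℝ) - 1) * (S.α * S.L * S.ng) := by
    simp [matB, matA, matE]
  have e01 : S.matB d 0 1 = S.L / S.μ / √(n : ℝ) * (1 - (1 - S.α * S.μ) ^ S.ng)
      + S.α * S.L * ((S.ng : ℝ) - 1) * (S.α * S.L * S.ng / √(n : ℝ)) := by
    simp [matB, matA, matE, κ]
  have e02 : S.matB d 0 2 = S.α * S.L * ((S.ng : ℝ) - 1) * (S.α * S.ng / √(n : ℝ)) := by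
    simp [matB, matA, matE]
  have e10 : S.matB d 1 0
      = S.α * S.L * ((S.ng : ℝ) - 1) * (√(n : ℝ) * S.α * S.L * S.δ₁) := by
    simp [matB, matA, matE]
  have e11 : S.matB d 1 1
      = S.β₁ ^ S.nc + S.α * S.L * ((S.ng : ℝ) - 1) * (S.α * S.L * S.δ₁) := by
    simp [matB, matA, matE]
  have e12 : S.matB d 1 2 = S.α * (((S.ng : ℝ) - 1) * S.β₁ ^ S.nc + S.β₂ ^ S.nc)
      + S.α * S.L * ((S.ng : ℝ) - 1) * (S.α * S.δ₁) := by
    simp [matB, matA, matE]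
  have e20 : S.matB d 2 0 = √(n : ℝ) * S.α * S.β₄ ^ S.nc * S.L ^ 2
      + S.α * S.L * ((S.ng : ℝ) - 1) * (√(n : ℝ) * S.L * S.δ₂ d) := by
    simp [matB, matA, matE]
  have e21 : S.matB d 2 1 = S.β₄ ^ S.nc * S.L * (S.ζ d + S.α * S.L)
      + S.α * S.L * ((S.ng : ℝ) - 1) * (S.L * S.δ₂ d) := by
    simp [matB, matA, matE]
  have e22 : S.matB d 2 2 = S.β₃ ^ S.nc + S.α * S.β₄ ^ S.nc * S.L
      + S.α * S.L * ((S.ng : ℝ) - 1) * S.δ₂ d := by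
    simp [matB, matA, matE]
  obtain ⟨g, hg⟩ : ∃ g : ℝ, g = S.ng - 1 := ⟨_, rfl⟩
  have hg0 : 0 ≤ g := by linarith
  obtain ⟨D, hDe⟩ : ∃ D : ℝ, D = g * S.δ₁ := ⟨_, rfl⟩
  obtain ⟨Q, hQe⟩ : ∃ Q : ℝ, Q = S.β₄ ^ S.nc + g * S.δ₂ d := ⟨_, rfl⟩
  obtain ⟨P, hPe⟩ : ∃ P : ℝ, P = g * (S.β₁ ^ S.nc + S.δ₁) + S.β₂ ^ S.nc := ⟨_, rfl⟩
  rw [← hg] at h2 h4 hαLg hD e00 e01 e02 e10 e11 e12 e20 e21 e22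
  rw [← hDe] at hD
  rw [← hQe] at h4
  have hP : 0 ≤ P := by
    have := mul_nonneg hg0 p1
    rw [hPe, mul_add, ← hDe]
    positivity
  have hQ : S.β₄ ^ S.nc ≤ Q := by
    have := mul_nonneg hg0 hδ₂
    linarith
  have hQ0 : 0 ≤ Q := p4.trans hQ
  obtain ⟨c₁, hc₁e⟩ : ∃ c : ℝ, c = (1 - S.β₁ ^ S.nc) / 4 := ⟨_, rfl⟩
  obtain ⟨c₃, hc₃e⟩ : ∃ c : ℝ, c = (1 - S.β₃ ^ S.nc) / 4 := ⟨_, rfl⟩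
  have hc₁ : 0 < c₁ := by linarith
  have hc₃ : 0 < c₃ := by linarith
  have hb₁ : S.b₁ d = S.μ * S.L ^ 2 * S.ng / 2 * P * Q + S.L ^ 3 * S.ng * (D * c₃ + g * (Q * c₁))
      + S.L ^ 2 * g * (S.L * D * (2 * S.β₄ ^ S.nc + Q) + D * c₃)
      + S.L ^ 2 * Q * (S.L * S.ng + g) * P := by
    rw [b₁, ← hc₁e, ← hc₃e, ← hg, ← hPe, ← hQe, hDe, hQe]
    ring
  have hb₂ : S.b₂ = S.μ * S.ng * S.β₄ ^ S.nc * S.L * P := by rw [b₂, ← hg, ← hPe]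
  have hb₃ : S.b₃ = S.μ * S.ng / 2 * c₁ * c₃ := by rw [b₃, ← hc₁e, ← hc₃e]
  have hb := quadratic_lt_of_lt_root hα (by rw [hb₁]; positivity) (by rw [hb₂]; positivity) h5
  -- Since L³ ng D c₃ is a summand of b₁, the quadratic condition together with μ ≤ L already
  -- controls D. This leaves at least 2c₁ of the gap 4c₁ = 1 - β₁^nc on the diagonal.
  have hDbound : S.α ^ 2 * S.L ^ 2 * D ≤ 2 * c₁ := by
    have r1 : S.L ^ 3 * S.ng * (D * c₃) ≤ S.b₁ d := by
      have : 0 ≤ S.μ * S.L ^ 2 * S.ng / 2 * P * Q + S.L ^ 3 * S.ng * (g * (Q * c₁))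
        + S.L ^ 2 * g * (S.L * D * (2 * S.β₄ ^ S.nc + Q) + D * c₃)
        + S.L ^ 2 * Q * (S.L * S.ng + g) * P := by positivity
      linarith
    have r2 : 0 ≤ S.b₂ * S.α := by rw [hb₂]; positivity
    have r3 := mul_le_mul_of_nonneg_right r1 (sq_nonneg S.α)
    have r4 : S.L * S.ng * c₃ * (S.α ^ 2 * S.L ^ 2 * D) ≤ S.L * S.ng * c₃ * (2 * c₁) := by
      have r5 : S.μ * (S.ng / 2 * c₁ * c₃) ≤ S.L * (S.ng / 2 * c₁ * c₃) := by gcongr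
      have r6 : 0 ≤ S.L * (S.ng * c₁ * c₃) := by positivity
      rw [hb₃] at hb
      linarith
    exact le_of_mul_le_mul_left r4 (by positivity)
  have hbern : 1 - (1 - S.α * S.μ) ^ S.ng ≤ S.ng * (S.α * S.μ) := by
    have := one_add_mul_le_pow (by linarith : -2 ≤ -(S.α * S.μ)) S.ng
    rw [← sub_eq_add_neg] at this
    linarith
  -- The second step size term leaves half of the first-order decrease ng αμ in the first entry; the
  -- fourth term uses at most 3c₃ of the gap 4c₃ in the third.
  refine rho_lt_one_of_det_pos hB (c₀ := S.ng * S.α * S.μ / 2) (c₁ := 2 * c₁) (c₂ := c₃)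
    (by positivity) (by positivity) hc₃ ?_ ?_ ?_ ?_
  · have := one_sub_pow_le hαμ0 hαμ S.ng
    rw [← hg] at this
    have h3 := mul_le_mul_of_nonneg_left h2 (by positivity : 0 ≤ S.ng * S.α)
    rw [e00]
    linarith
  · rw [e11]
    rw [hDe] at hDbound
    linarith
  · rw [e22]
    rw [hQe] at h4
    linarith
  · refine det_pos_of_step_size hα hμ hL hm hg hs p4 hD hP hQ hc₁ hc₃ h1.le ?_ hb₂.ge
      (hb₃ ▸ hb) ?_ ?_ ?_ ?_ ?_ ?_ (hB _ _) (hB _ _) (hB _ _) (hB _ _)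
    · rw [hb₁]
      have r1 : 0 ≤ S.L ^ 2 * g * (D * c₃) := by positivity
      have r2 : 0 ≤ S.L ^ 2 * Q * g * P := by positivity
      linarith
    -- Bernoulli's inequality bounds the first summand by L ng α/√n and αL(ng - 1) ≤ 1 bounds the
    -- second by the same, hence the factor 2.
    · rw [e01]
      calc _ ≤ S.L / S.μ / √(n : ℝ) * (S.ng * (S.α * S.μ))
            + 1 * (S.α * S.L * S.ng / √(n : ℝ)) := by gcongr
        _ = _ := by field_simp; ring
    · rw [e02]
      exact le_of_eq (by ring)
    · rw [e10, hDe]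
      exact le_of_eq (by ring)
    · rw [e12, hPe]
      have := mul_le_mul_of_nonneg_right hαL1 (mul_nonneg hα.le hD)
      rw [hDe] at this
      linarith
    · rw [e20, hQe]
      exact le_of_eq (by ring)
    · rw [e21, hQe]
      have := mul_le_mul_of_nonneg_left hζ (mul_nonneg p4 hL.le)
      linarith

lemma average_iterate_snd (hW₃ : S.W₃ ∈ doublyStochastic ℝ (Fin n))
    (hW₄ : S.W₄ ∈ doublyStochastic ℝ (Fin n)) (f : Fin n → Vec d → ℝ) (x₀ : Stacked n d) (k : ℕ) :
    average (S.iterate f x₀ k).2 = average (stackedGradient f (S.iterate f x₀ k).1) := by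
  induction k with
  | zero => rfl
  | succ k ih =>
    have e : S.iterate f x₀ (k + 1) = S.outerStep f (S.iterate f x₀ k) := by
      simp only [iterate, Function.iterate_succ_apply']
    rw [e]
    exact average_outerStep_snd ih hW₃ hW₄

lemma errorVec_nonneg (f : Fin n → Vec d → ℝ) (xstar : Vec d) (x₀ : Stacked n d) (k : ℕ)
    (i : Fin 3) : 0 ≤ S.errorVec f xstar x₀ k i := by
  fin_cases i <;> exact norm_nonneg _

/-- The error vectors satisfy the linear recursion governed by `B`. -/
lemma errorVec_succ_le (hn : 0 < n) (hW₁ : S.W₁ ∈ doublyStochastic ℝ (Fin n))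
    (hW₂ : S.W₂ ∈ doublyStochastic ℝ (Fin n)) (hW₃ : S.W₃ ∈ doublyStochastic ℝ (Fin n))
    (hW₄ : S.W₄ ∈ doublyStochastic ℝ (Fin n)) (hμ : 0 < S.μ) (hL : 0 < S.L) (hα : 0 < S.α)
    (hnc : 1 ≤ S.nc) (hng : 1 ≤ S.ng) (hαL : S.α * S.L * S.ng ≤ 1) (hαμ : S.α * S.μ < 1)
    {f : Fin n → Vec d → ℝ} {xstar : Vec d} (hf : StronglyConvexSmooth S.μ S.L f)
    (hmin : IsMinOn (globalObjective f) Set.univ xstar) (x₀ : Stacked n d) (k : ℕ) (i : Fin 3) :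
    S.errorVec f xstar x₀ (k + 1) i ≤ (S.matB d).mulVec (S.errorVec f xstar x₀ k) i := by
  have hs := average_iterate_snd (S := S) hW₃ hW₄ f x₀ k
  have e : S.iterate f x₀ (k + 1) = S.outerStep f (S.iterate f x₀ k) := by
    simp only [iterate, Function.iterate_succ_apply']
  have hsn : √(n : ℝ) ≠ 0 := by positivity
  simp only [errorVec, e]
  set s := S.iterate f x₀ k
  fin_cases i
  · refine (optimality_outerStep_le hn hng hμ hL.le hα.le hαL hαμ hf hmin hs hW₁ hW₂).trans
      (le_of_eq ?_)
    simp [Matrix.mulVec, dotProduct, Fin.sum_univ_three, matB, matA, matE, trackingBound, κ]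
    field_simp
    ring
  · refine (consensus_x_outerStep_le hn hng hnc hL.le hα.le hαL hf hmin hs hW₁ hW₂).trans
      (le_of_eq ?_)
    simp [Matrix.mulVec, dotProduct, Fin.sum_univ_three, matB, matA, matE, trackingBound]
    ring
  · refine (consensus_y_outerStep_le hn hng hnc hL.le hα.le hαL hf hmin hs hW₁ hW₂ hW₃
      hW₄).trans (le_of_eq ?_)
    simp [Matrix.mulVec, dotProduct, Fin.sum_univ_three, matB, matA, matE, trackingBound]
    ring

end GTASetup

/-- A nonnegative sequence of vectors dominated by a linear recursion is dominated by the powers of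
its matrix. -/
lemma le_pow_mulVec_of_le_mulVec {ι : Type*} [Fintype ι] [DecidableEq ι] {B : Matrix ι ι ℝ}
    (hB : ∀ i j, 0 ≤ B i j) {r : ℕ → ι → ℝ} (hr : ∀ k i, r (k + 1) i ≤ B.mulVec (r k) i) (k : ℕ)
    (i : ι) : r k i ≤ (B ^ k).mulVec (r 0) i := by
  induction k generalizing i with
  | zero => simp
  | succ k ih =>
    refine (hr k i).trans ?_
    rw [pow_succ', ← Matrix.mulVec_mulVec]
    exact Finset.sum_le_sum fun j _ => mul_le_mul_of_nonneg_left (ih j) (hB i j)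

/-- Linear convergence of the gradient tracking algorithm with `nc ≥ 1` communication steps and
`ng ≥ 1` computation steps per outer iteration. The constant `C` depends neither on the functions
`f_i` nor on the starting point. -/
theorem mainTheorem1 {n d : ℕ} (hn : 0 < n) (hd : 0 < d) (G : SimpleGraph (Fin n))
    (S : GTASetup n)
    (hW₁ : IsCommunicationMatrix G S.W₁) (hW₂ : IsCommunicationMatrix G S.W₂)
    (hW₃ : IsCommunicationMatrix G S.W₃) (hW₄ : IsCommunicationMatrix G S.W₄)
    (hμ : 0 < S.μ) (hL : 0 < S.L) (hα : 0 < S.α) (hnc : 1 ≤ S.nc) (hng : 1 ≤ S.ng)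
    (hB : (S.matB d).IsIrreducible) (hβ₁ : S.β₁ < 1) (hβ₃ : S.β₃ < 1)
    (hstep : (S.α : EReal) < S.stepBound d) :
    (∀ f : Fin n → Vec d → ℝ, StronglyConvexSmooth S.μ S.L f → rho (S.matB d) < 1) ∧
    ∀ ε : ℝ, 0 < ε → ∃ C : ℝ, 0 < C ∧
      ∀ (f : Fin n → Vec d → ℝ) (xstar : Vec d), StronglyConvexSmooth S.μ S.L f →
        IsMinOn (globalObjective f) Set.univ xstar →
        ∀ (x₀ : Stacked n d) (k : ℕ),
          ‖S.errorVec f xstar x₀ k‖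
            ≤ C * (rho (S.matB d) + ε) ^ k * ‖S.errorVec f xstar x₀ 0‖ := by
  -- The function f enters the spectral bound only through μ ≤ L.
  refine ⟨fun f hf => GTASetup.rho_matB_lt_one hn hW₁.doublyStochastic hμ hL hα hnc hng hB.nonneg
    hβ₁ hβ₃ (hf.le hn hd) hstep, fun ε hε => ?_⟩
  obtain ⟨C, hC, hpow⟩ := exists_abs_pow_le (S.matB d) hε
  -- Each of the three coordinates is at most 3T, so the norm is at most √27 T ≤ 6T.
  refine ⟨6 * C, by positivity, fun f xstar hf hmin x₀ k => ?_⟩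
  have hρ : 0 ≤ rho (S.matB d) := ENNReal.toReal_nonneg
  have hαL := (GTASetup.step_lt_of_lt_stepBound hL hμ hα hng (S.δ₂_nonneg d) hstep).1
  have hαμ : S.α * S.μ < 1 := by
    have hm : (1 : ℝ) ≤ S.ng := by exact_mod_cast hng
    have h1 := mul_le_mul_of_nonneg_left (hf.le hn hd) hα.le
    nlinarith [mul_pos hα hL]
  have hrec := le_pow_mulVec_of_le_mulVec (r := fun k => S.errorVec f xstar x₀ k) hB.nonneg
    (GTASetup.errorVec_succ_le hn hW₁.doublyStochastic hW₂.doublyStochastic hW₃.doublyStochastic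
      hW₄.doublyStochastic hμ hL hα hnc hng hαL.le hαμ hf hmin x₀) k
  have hentry : ∀ i, S.errorVec f xstar x₀ k i
      ≤ 3 * (C * (rho (S.matB d) + ε) ^ k * ‖S.errorVec f xstar x₀ 0‖) := by
    intro i
    refine (hrec i).trans ?_
    have : ∀ j ∈ Finset.univ, (S.matB d ^ k) i j * S.errorVec f xstar x₀ 0 j
        ≤ C * (rho (S.matB d) + ε) ^ k * ‖S.errorVec f xstar x₀ 0‖ := by
      intro j _
      have h0 := S.errorVec_nonneg f xstar x₀ 0 j
      have h1 := PiLp.norm_apply_le (S.errorVec f xstar x₀ 0) j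
      rw [Real.norm_of_nonneg h0] at h1
      exact mul_le_mul ((le_abs_self _).trans (hpow k i j)) h1 h0 (by positivity)
    refine (Finset.sum_le_card_nsmul _ _ _ this).trans (le_of_eq ?_)
    simp
  refine le_of_sq_le_sq ?_ (by positivity)
  rw [EuclideanSpace.norm_sq_eq, Fin.sum_univ_three]
  set T := C * (rho (S.matB d) + ε) ^ k * ‖S.errorVec f xstar x₀ 0‖ with hT
  have hsq : ∀ i, ‖S.errorVec f xstar x₀ k i‖ ^ 2 ≤ 9 * T ^ 2 := by
    intro i
    have h0 := S.errorVec_nonneg f xstar x₀ k i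
    rw [Real.norm_of_nonneg h0]
    calc _ ≤ (3 * T) ^ 2 := pow_le_pow_left₀ h0 (hentry i) 2
      _ = _ := by ring
  have e : 6 * C * (rho (S.matB d) + ε) ^ k * ‖S.errorVec f xstar x₀ 0‖ = 6 * T := by
    rw [hT]; ring
  rw [e]
  nlinarith [hsq 0, hsq 1, hsq 2, sq_nonneg T]
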